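/- Let $N\ge 1$, let $A=[a_{ij}]\in\mathbb{R}^{N\times N}$ be a nonzero skew-symmetric matrix, $a=\max_{i,j}|a_{ij}|$, and let $t>0$. Let $G$ be the graph on $\{1,\dots,N\}$ in which $i$ and $j$ are adjacent iff $a_{ij}\neq 0$, with the weight $\omega(\{i,j\})=|a_{ij}|^2$ on each edge. With $n=\lfloor N/2\rfloor$ let $$\Phi(t)=\sum_{k=0}^{n}\phi_k\,t^{\,n-k},\qquad \phi_k=\sum_{M}\ \prod_{e\in M}\omega(e),$$ where $M$ runs over the sets of $k$ pairwise vertex-disjoint edges of $G$. Let $x_{ij}$, $1\le i\le j\le N$, be independent standard Gaussian random variables, let $Y_A=[a_{ij}x_{\min(i,j)\max(i,j)}]_{i,j=1}^N$, and define $\tilde\Phi(t)$ by $$\log\tilde\Phi(t)=\begin{cases}\mathrm{E}\log\det(\sqrt t\,I_N+Y_A) & \text{if } N \text{ is even},\\ \mathrm{E}\log\det(\sqrt t\,I_N+Y_A)-\tfrac12\log t & \text{if } N\text{ is odd}.\end{cases}$$ Then $\log\det(\sqrt t\,I_N+Y_A)$ is integrable, and $$\frac1N\log\tilde\Phi(t)\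 \le\ \frac1N\log\Phi(t)\ \le\ \frac1N\log\tilde\Phi(t)+\min\!\Big(\frac{a^2}{2t},\,C_1\Big),$$ where $$C_1=-\frac1{\sqrt{2\pi}}\int_{\mathbb{R}}\log(x^2)\,e^{-x^2/2}\,dx .$$ -/

import Mathlib

noncomputable section

open MeasureTheory ProbabilityTheory

namespace MatchingEstimate

/-- A set `M` of edges of `G` is a matching if no two distinct edges of `M` have a common vertex. -/
def IsMatchingSet {V : Type*} (G : SimpleGraph V) (M : Finset (Sym2 V)) : Prop :=
  (∀ e ∈ M, e ∈ G.edgeSet) ∧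
    ∀ e ∈ M, ∀ f ∈ M, e ≠ f → ∀ v : V, v ∈ e → v ∉ f

open Classical in
/-- The finite set of all `k`-matchings of `G`. -/
def kMatchings {V : Type*} [Fintype V] (G : SimpleGraph V) (k : ℕ) : Finset (Finset (Sym2 V)) :=
  Finset.univ.filter fun M => IsMatchingSet G M ∧ M.card = k

/-- The total weighted `k`-matching `φ(k, G_w)`: the sum over all `k`-matchings of the product of
the weights of their edges (only the values of `w` on edges of `G` matter). -/
def totalMatching {V : Type*} [Fintype V] (G : SimpleGraph V) (w : Sym2 V → ℝ) (k : ℕ) : ℝ :=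
  ∑ M ∈ kMatchings G k, ∏ e ∈ M, w e

/-- The weighted matching polynomial
`Φ(t, G_w) = ∑_{k=0}^n φ(k, G_w) t^(n-k)` with `n = ⌊#V / 2⌋`. -/
def matchingPoly {V : Type*} [Fintype V] (G : SimpleGraph V) (w : Sym2 V → ℝ) (t : ℝ) : ℝ :=
  ∑ k ∈ Finset.range (Fintype.card V / 2 + 1),
    totalMatching G w k * t ^ (Fintype.card V / 2 - k)

variable {N : ℕ}

/-- The graph of a skew symmetric matrix `A`: `i` and `j` are adjacent iff `a_ij ≠ 0`. -/
def skewGraph (A : Matrix (Fin N) (Fin N) ℝ) (hA : A.transpose = -A) :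
    SimpleGraph (Fin N) where
  Adj i j := A i j ≠ 0
  symm := ⟨fun i j h => by
    have h1 : A j i = -A i j := congrFun (congrFun hA i) j
    rw [h1]
    exact neg_ne_zero.mpr h⟩
  loopless := ⟨fun i h => h (by
    have h1 : A i i = -A i i := congrFun (congrFun hA i) i
    linarith)⟩

/-- The weights of a skew symmetric matrix `A`: the pair `{i, j}` has weight `|a_ij|²`. -/
def skewWeight (A : Matrix (Fin N) (Fin N) ℝ) (hA : A.transpose = -A) : Sym2 (Fin N) → ℝ :=
  Sym2.lift ⟨fun i j => |A i j| ^ 2, fun i j => by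
    have h1 : A j i = -A i j := congrFun (congrFun hA i) j
    change |A i j| ^ 2 = |A j i| ^ 2
    rw [h1, abs_neg]⟩

/-- The index set of the variables `x_ij`, `i ≤ j`. -/
abbrev UpperPair (N : ℕ) : Type := {p : Fin N × Fin N // p.1 ≤ p.2}

/-- The matrix `Y_A(ξ) = [a_ij ξ_{min(i,j) max(i,j)}]`. -/
def sampleMatrix (A : Matrix (Fin N) (Fin N) ℝ) (ξ : UpperPair N → ℝ) :
    Matrix (Fin N) (Fin N) ℝ :=
  Matrix.of fun i j => A i j * ξ ⟨(min i j, max i j), min_le_max⟩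

/-- `log det (√t I + Y_A(ξ))`. -/
def logDet (A : Matrix (Fin N) (Fin N) ℝ) (t : ℝ) (ξ : UpperPair N → ℝ) : ℝ :=
  Real.log (Real.sqrt t • (1 : Matrix (Fin N) (Fin N) ℝ) + sampleMatrix A ξ).det

/-- The lower estimate of the matching polynomial obtained from the random variables `x`:
`exp (E log det (√t I + Y_A))` if `N` is even, and `t^(-1/2) exp (E log det (√t I + Y_A))` if `N`
is odd. (The expectation of the determinant itself is `Φ(t)` for even and `√t Φ(t)` for odd
`N`.) -/
def tildePhi {Ω : Type*} [MeasurableSpace Ω] (μ : Measure Ω) (x : UpperPair N → Ω → ℝ)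
    (A : Matrix (Fin N) (Fin N) ℝ) (t : ℝ) : ℝ :=
  if Even N then Real.exp (∫ ω, logDet A t (fun p => x p ω) ∂μ)
  else Real.exp (∫ ω, logDet A t (fun p => x p ω) ∂μ) / Real.sqrt t

/-- `C₁ = -(2π)^(-1/2) ∫ log (x²) exp (-x²/2) dx`. -/
def constC1 : ℝ :=
  -(1 / Real.sqrt (2 * Real.pi)) * ∫ x : ℝ, Real.log (x ^ 2) * Real.exp (-x ^ 2 / 2)

end MatchingEstimate

end

open MeasureTheory ProbabilityTheory

namespace MatchingEstimate

/-! Put `s = √t`. On average each principal minor of `s I + Y_A` equals the weighted sum of the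
matchings of its index set, with a factor `s` for every uncovered vertex. The task is to control
what is lost when the logarithm is taken before the mean, and this is done by averaging out one row
of Gaussian variables at a time.

The quantity carried along is a nonnegative combination `∑ T, c T * sampleMinor A s T z` of
principal minors. Since `s I + Y_A` is `s I` plus a skew matrix, all these minors are positive, and
bordering by row `k` gives `s` times the smaller minor plus a quadratic form in row `k`, positive
semidefinite because it comes from an adjugate. As a function of row `k` the combination is
therefore `c₀ + q(y)`, with `q` positive semidefinite and `q(y) ≤ (a²/s²) c₀ |y|²`. Its mean `c₀ +
tr q` is again a nonnegative combination of minors, now free of row `k`, and the passage from old to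
new coefficients is the matching recurrence at the vertex `k` (`matchingSum_eq_erase`). Hence the
same combination of matching sums never changes.

The analytic core is `gaussian_log_estimate`: `E log ((c₀ + q)/(c₀ + tr q))` lies between `-min
(a²/(2s²)) C₁` and `0`. The upper bound is Jensen's inequality. The bound by `a²/(2s²)` follows from
`log u ≥ 1 - 1/u` and Stein's identity. The bound by `C₁` follows from concavity of `log`, with `q`
written as a sum of squares of linear forms. The loss is uniform in the other rows, so `N` rows cost
at most `N` times it, and division by `N` gives the theorem. -/

/-- Resampling one coordinate preserves a product measure. -/
theorem measurePreserving_update {ι : Type*} [Fintype ι] [DecidableEq ι] {X : ι → Type*}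
    [∀ i, MeasurableSpace (X i)] (ν : ∀ i, Measure (X i)) [∀ i, IsProbabilityMeasure (ν i)]
    (k : ι) :
    MeasurePreserving (fun p : X k × (∀ i, X i) => Function.update p.2 k p.1)
      ((ν k).prod (Measure.pi ν)) (Measure.pi ν) := by
  have hm : Measurable (fun p : X k × (∀ i, X i) => Function.update p.2 k p.1) := by
    rw [measurable_pi_iff]
    intro i
    by_cases h : i = k
    · subst h
      simpa using measurable_fst
    · simp only [Function.update_of_ne h]
      fun_prop
  refine ⟨hm, ?_⟩
  symm
  refine Measure.pi_eq fun s hs => ?_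
  rw [Measure.map_apply hm (MeasurableSet.univ_pi hs)]
  have : (fun p : X k × (∀ i, X i) => Function.update p.2 k p.1) ⁻¹' Set.univ.pi s
      = s k ×ˢ Set.univ.pi (Function.update s k Set.univ) := by
    ext ⟨x, y⟩
    simp only [Set.mem_preimage, Set.mem_pi, Set.mem_univ, forall_true_left, Set.mem_prod]
    constructor
    · intro h
      refine ⟨by simpa using h k, fun i => ?_⟩
      by_cases hi : i = k
      · subst hi; simp
      · simpa [hi] using h i
    · rintro ⟨h1, h2⟩ i
      by_cases hi : i = k
      · subst hi; simpa using h1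
      · simpa [hi] using h2 i
  rw [this, Measure.prod_prod, Measure.pi_pi, ← Finset.mul_prod_erase Finset.univ _ (Finset.mem_univ k),
    ← Finset.mul_prod_erase Finset.univ _ (Finset.mem_univ k)]
  simp only [Function.update_self, measure_univ, one_mul]
  congr 1
  refine Finset.prod_congr rfl fun i hi => ?_
  rw [Function.update_of_ne (Finset.ne_of_mem_erase hi)]

/-! ### Stein's identity for Gaussian measures. -/

theorem hasDerivAt_gaussianPDFReal (x : ℝ) :
    HasDerivAt (gaussianPDFReal 0 1) (-(x * gaussianPDFReal 0 1 x)) x := by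
  have h : HasDerivAt (fun y : ℝ => (√(2 * Real.pi * (1 : NNReal)))⁻¹
      * Real.exp (-(y - 0) ^ 2 / (2 * (1 : NNReal)))) _ x :=
    (((((hasDerivAt_id x).sub_const 0).pow 2).neg.div_const _).exp).const_mul _
  rw [gaussianPDFReal_def]
  convert h using 1
  simp
  ring

theorem integrable_mul_gaussianPDFReal :
    Integrable (fun x : ℝ => x * gaussianPDFReal 0 1 x) := by
  have h := (integrable_mul_exp_neg_mul_sq (b := 1 / 2) (by norm_num)).const_mul
    ((√(2 * Real.pi))⁻¹)
  refine h.congr (Filter.Eventually.of_forall fun x => ?_)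
  simp only [gaussianPDFReal_def]
  simp
  ring_nf

/-- Stein's identity for the standard Gaussian measure on the line. -/
theorem integral_mul_gaussianReal_eq_deriv {g g' : ℝ → ℝ} (hg : ∀ x, HasDerivAt g (g' x) x)
    {C C' : ℝ} (hC : ∀ x, |g x| ≤ C) (hC' : ∀ x, |g' x| ≤ C') :
    ∫ x, x * g x ∂(gaussianReal 0 1) = ∫ x, g' x ∂(gaussianReal 0 1) := by
  rw [integral_gaussianReal_eq_integral_smul one_ne_zero,
    integral_gaussianReal_eq_integral_smul one_ne_zero]
  simp only [smul_eq_mul]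
  have hgm : Measurable g :=
    (continuous_iff_continuousAt.2 fun x => (hg x).continuousAt).measurable
  have hgm' : Measurable g' := by
    have : g' = deriv g := funext fun x => (hg x).deriv.symm
    rw [this]; exact measurable_deriv g
  have i1 : Integrable (fun x => gaussianPDFReal 0 1 x * g x) :=
    (integrable_gaussianPDFReal 0 1).mul_bdd (c := C) hgm.aestronglyMeasurable
      (Filter.Eventually.of_forall hC)
  have i2 : Integrable (fun x => gaussianPDFReal 0 1 x * g' x) :=
    (integrable_gaussianPDFReal 0 1).mul_bdd (c := C') hgm'.aestronglyMeasurable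
      (Filter.Eventually.of_forall hC')
  have i3 : Integrable (fun x => x * gaussianPDFReal 0 1 x * g x) :=
    integrable_mul_gaussianPDFReal.mul_bdd (c := C) hgm.aestronglyMeasurable
      (Filter.Eventually.of_forall hC)
  have key := integral_eq_zero_of_hasDerivAt_of_integrable
    (fun x => (hasDerivAt_gaussianPDFReal x).mul (hg x))
    ((i3.neg.add i2).congr (Filter.Eventually.of_forall fun x => by simp)) i1
  have : ∫ x, (gaussianPDFReal 0 1 x * g' x - x * gaussianPDFReal 0 1 x * g x) = 0 := by
    refine (integral_congr_ae (Filter.Eventually.of_forall fun x => ?_)).trans key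
    ring
  rw [integral_sub i2 i3, sub_eq_zero] at this
  rw [this]
  congr 1; ext x; ring

/-- The standard Gaussian measure on `ℝ^ι`. -/
noncomputable abbrev stdGaussianPi (ι : Type*) [Fintype ι] : Measure (ι → ℝ) :=
  Measure.pi fun _ => gaussianReal 0 1

theorem hasLaw_dotProduct_stdGaussianPi {ι : Type*} [Fintype ι] (w : ι → ℝ) :
    HasLaw (fun y => w ⬝ᵥ y) (gaussianReal 0 (∑ i, w i ^ 2).toNNReal) (stdGaussianPi ι) := by
  have hm : Measurable (fun y : ι → ℝ => w ⬝ᵥ y) := by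
    unfold dotProduct
    exact Finset.measurable_sum _ fun i _ => (measurable_pi_apply i).const_mul _
  refine ⟨hm.aemeasurable, ?_⟩
  have h := IsGaussian.map_eq_gaussianReal (μ := stdGaussian (EuclideanSpace ℝ ι))
    (innerSL ℝ (WithLp.toLp 2 w))
  rw [integral_strongDual_stdGaussian, variance_dual_stdGaussian, innerSL_apply_norm,
    EuclideanSpace.real_norm_sq_eq, ← map_pi_eq_stdGaussian, Measure.map_map (by fun_prop)
    (by fun_prop)] at h
  rw [← h]
  congr 1
  ext y
  simp [PiLp.inner_apply, dotProduct, mul_comm]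

/-- Stein's identity for the standard Gaussian measure on `ℝ^ι`. -/
theorem integral_coord_mul_eq_partialDeriv {ι : Type*} [Fintype ι] [DecidableEq ι] (i : ι)
    {g h : (ι → ℝ) → ℝ} (hgm : Measurable g) (hhm : Measurable h)
    (hg : ∀ y x, HasDerivAt (fun x => g (Function.update y i x)) (h (Function.update y i x)) x)
    {C C' : ℝ} (hC : ∀ x, |g x| ≤ C) (hC' : ∀ x, |h x| ≤ C') :
    ∫ y, y i * g y ∂(stdGaussianPi ι) = ∫ y, h y ∂(stdGaussianPi ι) := by
  have mp := measurePreserving_update (fun _ : ι => gaussianReal 0 1) i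
  have hih : Integrable h (stdGaussianPi ι) :=
    Integrable.of_bound hhm.aestronglyMeasurable C' (Filter.Eventually.of_forall hC')
  have hiy : Integrable (fun y : ι → ℝ => y i) (stdGaussianPi ι) := by
    have e := measurePreserving_eval (fun _ : ι => gaussianReal 0 1) i
    exact e.integrable_comp_of_integrable (g := fun x : ℝ => x)
      ((memLp_id_gaussianReal 1).integrable le_rfl)
  have hig : Integrable (fun y => y i * g y) (stdGaussianPi ι) :=
    hiy.mul_bdd (c := C) hgm.aestronglyMeasurable (Filter.Eventually.of_forall hC)
  unfold stdGaussianPi at *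
  have hig' : Integrable (fun p : ℝ × (ι → ℝ) => Function.update p.2 i p.1 i
      * g (Function.update p.2 i p.1)) ((gaussianReal 0 1).prod (Measure.pi fun _ => gaussianReal 0 1)) :=
    mp.integrable_comp_of_integrable hig
  have hih' : Integrable (fun p : ℝ × (ι → ℝ) => h (Function.update p.2 i p.1))
      ((gaussianReal 0 1).prod (Measure.pi fun _ => gaussianReal 0 1)) :=
    mp.integrable_comp_of_integrable hih
  rw [← mp.map_eq, integral_map mp.aemeasurable (by rw [mp.map_eq]; exact hig.aestronglyMeasurable),
    integral_map mp.aemeasurable (by rw [mp.map_eq]; exact hih.aestronglyMeasurable),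
    integral_prod_symm _ hig',
    integral_prod_symm _ hih']
  congr 1; ext y
  simp only [Function.update_self]
  exact integral_mul_gaussianReal_eq_deriv (hg y) (fun x => hC _) (fun x => hC' _)

/-! ### The logarithmic moment of a Gaussian variable and the constant `constC1`. -/

theorem abs_log_sq_le (x : ℝ) : |Real.log (x ^ 2)| ≤ 2 * |x| + 4 * |x| ^ (-(1 / 2) : ℝ) := by
  rcases eq_or_ne x 0 with rfl | hx
  · simp
  have hp : 0 < |x| := abs_pos.2 hx
  have hr : 0 < |x| ^ (-(1 / 2) : ℝ) := Real.rpow_pos_of_pos hp _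
  -- The inequality `log r ≤ r - 1` at `|x|` controls large `x`, and at `|x| ^ (-1/2)` small `x`;
  -- the exponent `-1/2` keeps the majorant integrable at `0`.
  have h1 := Real.log_le_sub_one_of_pos hp
  have h2 := Real.log_le_sub_one_of_pos hr
  rw [Real.log_rpow hp] at h2
  have : Real.log (x ^ 2) = 2 * Real.log |x| := by
    rw [← sq_abs, Real.log_pow]; norm_num
  rw [this, abs_le]
  constructor <;> linarith

theorem integrable_gaussianReal_iff {f : ℝ → ℝ} :
    Integrable f (gaussianReal 0 1) ↔ Integrable fun x => gaussianPDFReal 0 1 x * f x := by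
  rw [gaussianReal_of_var_ne_zero _ one_ne_zero,
    integrable_withDensity_iff_integrable_smul' (measurable_gaussianPDF 0 1)
      (Filter.Eventually.of_forall fun _ => gaussianPDF_lt_top)]
  simp [toReal_gaussianPDF]

theorem measurable_log_sq : Measurable fun x : ℝ => Real.log (x ^ 2) :=
  Real.measurable_log.comp (measurable_id.pow_const 2)

theorem integrable_log_sq_gaussianReal :
    Integrable (fun x : ℝ => Real.log (x ^ 2)) (gaussianReal 0 1) := by
  have h0 : Integrable (fun x : ℝ => |x| ^ (-(1 / 2) : ℝ)) (gaussianReal 0 1) := by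
    rw [integrable_gaussianReal_iff]
    have h1 := (integrable_rpow_mul_exp_neg_mul_sq (b := 1 / 2) (by norm_num)
      (s := -(1 / 2)) (by norm_num)).norm
    have h2 := (h1.add h1.comp_neg).const_mul ((√(2 * Real.pi))⁻¹)
    refine h2.mono' (by fun_prop) (Filter.Eventually.of_forall fun x => ?_)
    rw [Real.norm_of_nonneg (mul_nonneg (gaussianPDFReal_nonneg _ _ _) (by positivity)),
      gaussianPDFReal_def, mul_assoc]
    have hE : Real.exp (-(x - 0) ^ 2 / (2 * ((1 : NNReal) : ℝ))) = Real.exp (-(1 / 2) * x ^ 2) := by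
      congr 1; simp; ring
    simp only [NNReal.coe_one, mul_one, Pi.add_apply] at hE ⊢
    rw [hE]
    refine mul_le_mul_of_nonneg_left ?_ (by positivity)
    rw [norm_mul, norm_mul, neg_sq, Real.norm_of_nonneg (Real.exp_pos _).le, ← add_mul, mul_comm]
    refine mul_le_mul_of_nonneg_right ?_ (Real.exp_pos _).le
    rcases le_total 0 x with h | h
    · rw [abs_of_nonneg h]
      exact (le_abs_self _).trans (le_add_of_nonneg_right (norm_nonneg _))
    · rw [abs_of_nonpos h]
      exact (le_abs_self _).trans (le_add_of_nonneg_left (norm_nonneg _))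
  have h3 : Integrable (fun x : ℝ => |x|) (gaussianReal 0 1) :=
    ((memLp_id_gaussianReal 1).integrable le_rfl).abs
  refine ((h3.const_mul 2).add (h0.const_mul 4)).mono' measurable_log_sq.aestronglyMeasurable
    (Filter.Eventually.of_forall fun x => abs_log_sq_le x)

theorem integral_log_sq_gaussianReal :
    ∫ x, Real.log (x ^ 2) ∂(gaussianReal 0 1) = -constC1 := by
  rw [integral_gaussianReal_eq_integral_smul one_ne_zero, constC1, neg_mul, neg_neg,
    ← integral_const_mul]
  congr 1; ext x
  simp [gaussianPDFReal_def]
  ring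

theorem integral_sq_gaussianReal (v : NNReal) : ∫ x, x ^ 2 ∂(gaussianReal 0 v) = v := by
  have h := variance_eq_sub (memLp_id_gaussianReal (μ := 0) (v := v) 2)
  rw [variance_id_gaussianReal] at h
  simp only [id_eq, integral_id_gaussianReal] at h
  simpa using h.symm

theorem integrable_sq_gaussianReal (v : NNReal) :
    Integrable (fun x : ℝ => x ^ 2) (gaussianReal 0 v) :=
  (memLp_id_gaussianReal (μ := 0) (v := v) 2).integrable_sq

/-- Jensen's inequality: `E log x² ≤ E x² - 1 = 0`. -/
theorem constC1_nonneg : 0 ≤ constC1 := by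
  have h : ∫ x, Real.log (x ^ 2) ∂(gaussianReal 0 1) ≤ ∫ x, (x ^ 2) - 1 ∂(gaussianReal 0 1) := by
    refine integral_mono_ae integrable_log_sq_gaussianReal
      ((integrable_sq_gaussianReal 1).sub (integrable_const 1)) ?_
    have : ∀ᵐ x ∂(gaussianReal 0 1), x ≠ 0 := by
      have := nullSingletonClass_gaussianReal (μ := 0) (v := 1) one_ne_zero
      simp [ae_iff]
    filter_upwards [this] with x hx
    exact Real.log_le_sub_one_of_pos (by positivity)
  rw [integral_sub (integrable_sq_gaussianReal 1) (integrable_const 1), integral_sq_gaussianReal,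
    integral_log_sq_gaussianReal] at h
  simp at h
  exact h

/-! ### Sums of squares of linear forms in a Gaussian vector. -/

section QuadraticForm

variable {ι κ : Type*} [Fintype ι] [Fintype κ] (w : κ → ι → ℝ)

theorem integrable_dotProduct_sq (v : ι → ℝ) :
    Integrable (fun y => (v ⬝ᵥ y) ^ 2) (stdGaussianPi ι) := by
  have h := hasLaw_dotProduct_stdGaussianPi v
  have := integrable_sq_gaussianReal (∑ i, v i ^ 2).toNNReal
  rw [← h.map_eq, integrable_map_measure (by fun_prop) h.aemeasurable] at this
  exact this

theorem integral_dotProduct_sq (v : ι → ℝ) :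
    ∫ y, (v ⬝ᵥ y) ^ 2 ∂(stdGaussianPi ι) = ∑ i, v i ^ 2 := by
  have h := hasLaw_dotProduct_stdGaussianPi v
  have h2 := integral_sq_gaussianReal (∑ i, v i ^ 2).toNNReal
  rw [← h.map_eq, integral_map h.aemeasurable (by fun_prop)] at h2
  rw [h2, Real.coe_toNNReal _ (by positivity)]

/-- The squared normalization of a Gaussian linear form has the law of a squared standard
Gaussian variable. -/
theorem integral_log_dotProduct_sq {v : ι → ℝ} (hv : 0 < ∑ i, v i ^ 2) :
    (∀ᵐ y ∂(stdGaussianPi ι), v ⬝ᵥ y ≠ 0) ∧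
    Integrable (fun y => Real.log ((v ⬝ᵥ y) ^ 2 / ∑ i, v i ^ 2)) (stdGaussianPi ι) ∧
    ∫ y, Real.log ((v ⬝ᵥ y) ^ 2 / ∑ i, v i ^ 2) ∂(stdGaussianPi ι) = -constC1 := by
  set r := √(∑ i, v i ^ 2) with hr
  have hr0 : 0 < r := Real.sqrt_pos.2 hv
  have hr2 : r ^ 2 = ∑ i, v i ^ 2 := Real.sq_sqrt hv.le
  have h := hasLaw_dotProduct_stdGaussianPi (r⁻¹ • v)
  have h1 : (∑ i, (r⁻¹ • v) i ^ 2).toNNReal = 1 := by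
    simp only [Pi.smul_apply, smul_eq_mul, mul_pow, ← Finset.mul_sum, ← hr2]
    rw [inv_pow, inv_mul_cancel₀ (by positivity), Real.toNNReal_one]
  rw [h1] at h
  have hlog : (fun y => Real.log ((v ⬝ᵥ y) ^ 2 / ∑ i, v i ^ 2))
      = fun y => Real.log (((r⁻¹ • v) ⬝ᵥ y) ^ 2) := by
    ext y
    rw [← hr2, smul_dotProduct, smul_eq_mul, mul_pow, inv_pow, div_eq_inv_mul]
  rw [hlog]
  refine ⟨?_, ?_, ?_⟩
  · have : ∀ᵐ x ∂(gaussianReal 0 1), x ≠ 0 := by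
      have := nullSingletonClass_gaussianReal (μ := 0) (v := 1) one_ne_zero
      simp [ae_iff]
    rw [← h.map_eq] at this
    filter_upwards [ae_of_ae_map h.aemeasurable this] with y hy h0
    exact hy (by rw [smul_dotProduct, h0, smul_zero])
  · have := integrable_log_sq_gaussianReal
    rw [← h.map_eq, integrable_map_measure measurable_log_sq.aestronglyMeasurable h.aemeasurable] at this
    exact this
  · have := integral_log_sq_gaussianReal
    rw [← h.map_eq, integral_map h.aemeasurable measurable_log_sq.aestronglyMeasurable] at this
    exact this

/-- The sum of the squares of the linear forms `w k`. -/
def sumSq (y : ι → ℝ) : ℝ := ∑ k, (w k ⬝ᵥ y) ^ 2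

/-- Half the gradient of `sumSq w`. -/
def sumSqGrad (y : ι → ℝ) (i : ι) : ℝ := ∑ k, (w k ⬝ᵥ y) * w k i

theorem sumSq_nonneg (y : ι → ℝ) : 0 ≤ sumSq w y := Finset.sum_nonneg fun _ _ => sq_nonneg _

theorem measurable_dotProduct_left (v : ι → ℝ) : Measurable fun y : ι → ℝ => v ⬝ᵥ y := by
  unfold dotProduct
  exact Finset.measurable_sum _ fun i _ => (measurable_pi_apply i).const_mul _

theorem measurable_sumSq : Measurable (sumSq w) :=
  Finset.measurable_sum _ fun k _ => (measurable_dotProduct_left (w k)).pow_const 2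

theorem measurable_sumSqGrad (i : ι) : Measurable fun y => sumSqGrad w y i :=
  Finset.measurable_sum _ fun k _ => (measurable_dotProduct_left (w k)).mul_const _

theorem integrable_sumSq : Integrable (sumSq w) (stdGaussianPi ι) :=
  integrable_finsetSum _ fun k _ => integrable_dotProduct_sq (w k)

theorem integral_sumSq : ∫ y, sumSq w y ∂(stdGaussianPi ι) = ∑ k, ∑ i, w k i ^ 2 := by
  unfold sumSq
  rw [integral_finsetSum _ fun k _ => integrable_dotProduct_sq (w k)]
  exact Finset.sum_congr rfl fun k _ => integral_dotProduct_sq (w k)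

theorem sum_coord_mul_sumSqGrad (y v : ι → ℝ) :
    ∑ i, v i * sumSqGrad w y i = ∑ k, (w k ⬝ᵥ y) * (w k ⬝ᵥ v) := by
  simp only [sumSqGrad, Finset.mul_sum, dotProduct]
  rw [Finset.sum_comm]
  refine Finset.sum_congr rfl fun k _ => Finset.sum_congr rfl fun i _ => by ring

/-- For `v = sumSqGrad w y`, Cauchy–Schwarz gives `|v|⁴ ≤ q(y) q(v) ≤ q(y) b |v|²`, and one factor
`|v|²` cancels. -/
theorem sum_sumSqGrad_sq_le {b : ℝ} (hb : ∀ y, sumSq w y ≤ b * ∑ i, y i ^ 2) (y : ι → ℝ) :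
    ∑ i, sumSqGrad w y i ^ 2 ≤ b * sumSq w y := by
  set v := sumSqGrad w y with hv
  have h1 : ∑ i, v i ^ 2 = ∑ k, (w k ⬝ᵥ y) * (w k ⬝ᵥ v) := by
    rw [← sum_coord_mul_sumSqGrad]
    exact Finset.sum_congr rfl fun i _ => by rw [sq]
  have h2 : (∑ i, v i ^ 2) ^ 2 ≤ sumSq w y * sumSq w v := by
    rw [h1]
    exact Finset.sum_mul_sq_le_sq_mul_sq _ _ _
  have h3 := hb v
  have h4 : 0 ≤ ∑ i, v i ^ 2 := by positivity
  have h5 := sumSq_nonneg w y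
  rcases h4.eq_or_lt with h | h
  · rw [← h]
    have h6 := hb y
    by_cases hy : sumSq w y = 0
    · rw [hy, mul_zero]
    · have h7 : 0 < sumSq w y := lt_of_le_of_ne h5 (Ne.symm hy)
      have h8 : 0 ≤ ∑ i, y i ^ 2 := by positivity
      have : 0 ≤ b := by
        by_contra hb'
        nlinarith
      positivity
  · have : (∑ i, v i ^ 2) * (∑ i, v i ^ 2) ≤ (b * sumSq w y) * (∑ i, v i ^ 2) := by
      nlinarith [mul_le_mul_of_nonneg_left h3 h5]
    exact le_of_mul_le_mul_right this h

end QuadraticForm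

/-! ### The logarithmic loss for a constant plus a quadratic form. -/

section QuadraticForm

variable {ι κ : Type*} [Fintype ι] [Fintype κ] (w : κ → ι → ℝ)

theorem hasDerivAt_dotProduct_update [DecidableEq ι] (v y : ι → ℝ) (i : ι) (x : ℝ) :
    HasDerivAt (fun x => v ⬝ᵥ Function.update y i x) (v i) x := by
  have h : ∀ j ∈ Finset.univ, HasDerivAt (fun x => v j * Function.update y i x j)
      (v j * (Pi.single i (1 : ℝ) : ι → ℝ) j) x :=
    fun j _ => ((hasDerivAt_pi.1 (hasDerivAt_update y i x)) j).const_mul (v j)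
  have h2 := HasDerivAt.fun_sum h
  simpa [dotProduct, Pi.single_apply] using h2

theorem hasDerivAt_sumSq_update [DecidableEq ι] (y : ι → ℝ) (i : ι) (x : ℝ) :
    HasDerivAt (fun x => sumSq w (Function.update y i x))
      (2 * sumSqGrad w (Function.update y i x) i) x := by
  have h2 := HasDerivAt.fun_sum (u := Finset.univ)
    fun k _ => (hasDerivAt_dotProduct_update (w k) y i x).pow 2
  refine h2.congr_deriv ?_
  rw [sumSqGrad, Finset.mul_sum]
  refine Finset.sum_congr rfl fun k _ => by simp; ring

theorem hasDerivAt_sumSqGrad_update [DecidableEq ι] (y : ι → ℝ) (i : ι) (x : ℝ) :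
    HasDerivAt (fun x => sumSqGrad w (Function.update y i x) i) (∑ k, w k i ^ 2) x := by
  have h2 := HasDerivAt.fun_sum (u := Finset.univ)
    fun k _ => (hasDerivAt_dotProduct_update (w k) y i x).mul_const (w k i)
  exact h2.congr_deriv (Finset.sum_congr rfl fun k _ => (sq (w k i)).symm)

variable {c b : ℝ}

/-- The squared gradient is at most `b c q`, and `4 c q ≤ (c + q)²`. -/
theorem sumSqGrad_sq_div_le (hc : 0 < c) (hb0 : 0 ≤ b)
    (hb : ∀ y, sumSq w y ≤ b * c * ∑ i, y i ^ 2) (y : ι → ℝ) :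
    ∑ i, (sumSqGrad w y i / (c + sumSq w y)) ^ 2 ≤ b / 4 := by
  have h := sum_sumSqGrad_sq_le w hb y
  have h0 := sumSq_nonneg w y
  simp only [div_pow]
  rw [← Finset.sum_div, div_le_iff₀ (by positivity)]
  nlinarith [mul_nonneg hb0 (sq_nonneg (c - sumSq w y))]

/-- Integration by parts for the expectation of `(tr - q) / (c + q)`. -/
theorem integral_trace_sub_div_le (hc : 0 < c) (hb0 : 0 ≤ b)
    (hb : ∀ y, sumSq w y ≤ b * c * ∑ i, y i ^ 2) :
    ∫ y, ((∑ k, ∑ i, w k i ^ 2) - sumSq w y) / (c + sumSq w y) ∂(stdGaussianPi ι) ≤ b / 2 := by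
  classical
  have hq := sumSq_nonneg w
  have hcq : ∀ y, 0 < c + sumSq w y := fun y => by linarith [hq y]
  set d : ι → ℝ := fun i => ∑ k, w k i ^ 2 with hd
  have hd0 : ∀ i, 0 ≤ d i := fun i => Finset.sum_nonneg fun _ _ => sq_nonneg _
  set g : ι → (ι → ℝ) → ℝ := fun i y => sumSqGrad w y i / (c + sumSq w y) with hg
  set h : ι → (ι → ℝ) → ℝ := fun i y => d i / (c + sumSq w y) - 2 * g i y ^ 2 with hh
  have hgm : ∀ i, Measurable (g i) := fun i =>
    (measurable_sumSqGrad w i).div ((measurable_sumSq w).const_add c)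
  have hhm : ∀ i, Measurable (h i) := fun i =>
    (((measurable_sumSq w).const_add c).const_div _).sub (((hgm i).pow_const 2).const_mul 2)
  have hgsum : ∀ y, ∑ i, g i y ^ 2 ≤ b / 4 := sumSqGrad_sq_div_le w hc hb0 hb
  have hgi : ∀ i y, g i y ^ 2 ≤ b / 4 := fun i y =>
    (Finset.single_le_sum (f := fun i => g i y ^ 2) (fun _ _ => sq_nonneg _)
      (Finset.mem_univ i)).trans (hgsum y)
  have hgb : ∀ i y, |g i y| ≤ √(b / 4) := fun i y => Real.abs_le_sqrt (hgi i y)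
  have hdc : ∀ i y, d i / (c + sumSq w y) ≤ d i / c := fun i y =>
    div_le_div_of_nonneg_left (hd0 i) hc (by linarith [hq y])
  have hdc0 : ∀ i y, 0 ≤ d i / (c + sumSq w y) := fun i y => div_nonneg (hd0 i) (hcq y).le
  have hhb : ∀ i y, |h i y| ≤ d i / c + b / 2 := by
    intro i y
    have := hgi i y
    have h1 := hdc i y
    have h2 := hdc0 i y
    have h3 := sq_nonneg (g i y)
    rw [abs_le]
    constructor <;> simp only [hh] <;> linarith
  -- `h i` is the partial derivative of `g i` in the `i`-th coordinate, and both are bounded.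
  have stein : ∀ i, ∫ y, y i * g i y ∂(stdGaussianPi ι) = ∫ y, h i y ∂(stdGaussianPi ι) := by
    intro i
    refine integral_coord_mul_eq_partialDeriv i (hgm i) (hhm i) (fun y x => ?_) (hgb i) (hhb i)
    have e := (hasDerivAt_sumSqGrad_update w y i x).div
      ((hasDerivAt_sumSq_update w y i x).const_add c) (hcq _).ne'
    refine e.congr_deriv ?_
    simp only [hh, hg, hd]
    have := (hcq (Function.update y i x)).ne'
    field_simp
  have ih : ∀ i, Integrable (h i) (stdGaussianPi ι) := fun i =>
    Integrable.of_bound (hhm i).aestronglyMeasurable _ (Filter.Eventually.of_forall (hhb i))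
  have ig : ∀ i, Integrable (fun y => y i * g i y) (stdGaussianPi ι) := by
    intro i
    have hiy : Integrable (fun y : ι → ℝ => y i) (stdGaussianPi ι) :=
      (measurePreserving_eval (fun _ : ι => gaussianReal 0 1) i).integrable_comp_of_integrable
        (g := fun x : ℝ => x) ((memLp_id_gaussianReal 1).integrable le_rfl)
    exact hiy.mul_bdd (c := √(b / 4)) (hgm i).aestronglyMeasurable
      (Filter.Eventually.of_forall (hgb i))
  have idiv : ∀ i, Integrable (fun y => d i / (c + sumSq w y)) (stdGaussianPi ι) := fun i =>
    Integrable.of_bound (((measurable_sumSq w).const_add c).const_div _).aestronglyMeasurable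
      (d i / c) (Filter.Eventually.of_forall fun y => by
        rw [Real.norm_of_nonneg (hdc0 i y)]; exact hdc i y)
  have key : ∀ y, ((∑ k, ∑ i, w k i ^ 2) - sumSq w y) / (c + sumSq w y)
      = ∑ i, (d i / (c + sumSq w y) - y i * g i y) := by
    intro y
    have h1 : sumSq w y = ∑ i, y i * sumSqGrad w y i := by
      rw [sum_coord_mul_sumSqGrad]
      exact Finset.sum_congr rfl fun k _ => sq _
    rw [Finset.sum_sub_distrib, ← Finset.sum_div, sub_div, Finset.sum_comm]
    congr 1
    conv_lhs => rw [h1, Finset.sum_div]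
    refine Finset.sum_congr rfl fun i _ => ?_
    rw [← h1, mul_div_assoc]
  -- By Stein's identity the terms `d i / (c + q)` cancel, and only the squared gradient term
  -- remains.
  have e1 : ∫ y, ((∑ k, ∑ i, w k i ^ 2) - sumSq w y) / (c + sumSq w y) ∂(stdGaussianPi ι)
      = ∫ y, ∑ i, 2 * g i y ^ 2 ∂(stdGaussianPi ι) := by
    have i2 : ∀ i, Integrable (fun y => 2 * g i y ^ 2) (stdGaussianPi ι) := fun i =>
      ((idiv i).sub (ih i)).congr (Filter.Eventually.of_forall fun y => by simp [hh])
    have is : ∀ i, Integrable (fun y => d i / (c + sumSq w y) - y i * g i y) (stdGaussianPi ι) :=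
      fun i => (idiv i).sub (ig i)
    simp only [key]
    rw [integral_finsetSum _ fun i _ => is i, integral_finsetSum _ fun i _ => i2 i]
    refine Finset.sum_congr rfl fun i _ => ?_
    rw [integral_sub (idiv i) (ig i), stein i, ← integral_sub (idiv i) (ih i)]
    congr 1; ext y; simp [hh]
  rw [e1]
  have e2 : ∫ y, ∑ i, 2 * g i y ^ 2 ∂(stdGaussianPi ι) ≤ ∫ _, b / 2 ∂(stdGaussianPi ι) := by
    refine integral_mono_of_nonneg
      (Filter.Eventually.of_forall fun y => Finset.sum_nonneg fun _ _ => by positivity)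
      (integrable_const _) (Filter.Eventually.of_forall fun y => ?_)
    simp only [← Finset.mul_sum]
    linarith [hgsum y]
  simpa using e2

/-- The logarithm of `c + q(y)`, normalized by the mean of `c + q`. -/
theorem gaussian_log_estimate (hc : 0 < c) (hb0 : 0 ≤ b)
    (hb : ∀ y, sumSq w y ≤ b * c * ∑ i, y i ^ 2) :
    Integrable (fun y => Real.log ((c + sumSq w y) / (c + ∑ k, ∑ i, w k i ^ 2)))
      (stdGaussianPi ι) ∧
    ∫ y, Real.log ((c + sumSq w y) / (c + ∑ k, ∑ i, w k i ^ 2)) ∂(stdGaussianPi ι) ≤ 0 ∧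
    -min (b / 2) constC1 ≤
      ∫ y, Real.log ((c + sumSq w y) / (c + ∑ k, ∑ i, w k i ^ 2)) ∂(stdGaussianPi ι) ∧
    ∫ y, ‖Real.log ((c + sumSq w y) / (c + ∑ k, ∑ i, w k i ^ 2))‖ ∂(stdGaussianPi ι) ≤
      2 + constC1 := by
  set τ := ∑ k, ∑ i, w k i ^ 2 with hτ
  have hq := sumSq_nonneg w
  have hτ0 : 0 ≤ τ := Finset.sum_nonneg fun _ _ => Finset.sum_nonneg fun _ _ => sq_nonneg _
  have hZ : 0 < c + τ := by linarith
  set u : (ι → ℝ) → ℝ := fun y => (c + sumSq w y) / (c + τ) with hu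
  have hcq : ∀ y, 0 < c + sumSq w y := fun y => by linarith [hq y]
  have hu0 : ∀ y, 0 < u y := fun y => div_pos (hcq y) hZ
  have hum : Measurable u := ((measurable_sumSq w).const_add c).div_const _
  have iu : Integrable u (stdGaussianPi ι) :=
    (((integrable_const c).add (integrable_sumSq w))).div_const _
  have Eu : ∫ y, u y ∂(stdGaussianPi ι) = 1 := by
    simp only [hu]
    rw [integral_div, integral_add (integrable_const c) (integrable_sumSq w), integral_sumSq]
    simp [← hτ, hZ.ne']
  have ilog : Integrable (fun y => Real.log (u y)) (stdGaussianPi ι) := by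
    refine (iu.add (integrable_const |Real.log (c / (c + τ))|)).mono'
      (Real.measurable_log.comp hum).aestronglyMeasurable (Filter.Eventually.of_forall fun y => ?_)
    have h1 := Real.log_le_sub_one_of_pos (hu0 y)
    have h2 : Real.log (c / (c + τ)) ≤ Real.log (u y) :=
      Real.log_le_log (by positivity) (div_le_div_of_nonneg_right (by linarith [hq y]) hZ.le)
    have h3 := neg_abs_le (Real.log (c / (c + τ)))
    have h4 := abs_nonneg (Real.log (c / (c + τ)))
    have h5 := hu0 y
    simp only [Pi.add_apply]
    rw [Real.norm_eq_abs, abs_le]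
    constructor <;> linarith
  have up : ∫ y, Real.log (u y) ∂(stdGaussianPi ι) ≤ 0 := by
    have : ∫ y, Real.log (u y) ∂(stdGaussianPi ι) ≤ ∫ y, (u y - 1) ∂(stdGaussianPi ι) :=
      integral_mono ilog (iu.sub (integrable_const 1)) fun y => Real.log_le_sub_one_of_pos (hu0 y)
    rw [integral_sub iu (integrable_const 1), Eu] at this
    simpa using this
  -- `log u ≥ 1 - 1/u`, and `1 - 1/u = -(τ - q)/(c + q)`, whose mean is controlled by integration by
  -- parts.
  have low1 : -(b / 2) ≤ ∫ y, Real.log (u y) ∂(stdGaussianPi ι) := by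
    have i1 : Integrable (fun y => (τ - sumSq w y) / (c + sumSq w y)) (stdGaussianPi ι) := by
      refine Integrable.of_bound (C := τ / c + 1) (((measurable_sumSq w).const_sub _).div
        ((measurable_sumSq w).const_add c)).aestronglyMeasurable
        (Filter.Eventually.of_forall fun y => ?_)
      have h1 : (τ - sumSq w y) / (c + sumSq w y)
          = τ / (c + sumSq w y) - sumSq w y / (c + sumSq w y) := sub_div _ _ _
      have h2 : τ / (c + sumSq w y) ≤ τ / c :=
        div_le_div_of_nonneg_left hτ0 hc (by linarith [hq y])
      have h3 : sumSq w y / (c + sumSq w y) ≤ 1 := by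
        rw [div_le_one (hcq y)]; linarith
      have h4 : 0 ≤ τ / (c + sumSq w y) := div_nonneg hτ0 (hcq y).le
      have h5 : 0 ≤ sumSq w y / (c + sumSq w y) := div_nonneg (hq y) (hcq y).le
      rw [h1, Real.norm_eq_abs, abs_le]
      constructor <;> linarith
    have h := integral_trace_sub_div_le w hc hb0 hb
    have : ∫ y, -((τ - sumSq w y) / (c + sumSq w y)) ∂(stdGaussianPi ι)
        ≤ ∫ y, Real.log (u y) ∂(stdGaussianPi ι) := by
      refine integral_mono i1.neg ilog fun y => ?_
      have h1 := Real.one_sub_inv_le_log_of_pos (hu0 y)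
      refine le_trans (le_of_eq ?_) h1
      have := (hcq y).ne'
      simp only [hu]
      field_simp
      ring
    rw [integral_neg] at this
    linarith
  -- `u` is a convex combination of `1`, with weight `c/(c+τ)`, and the normalized squares `(w k ⬝ᵥ
  -- y)² / p k`, with weights `p k/(c+τ)`. Concavity of `log` bounds `log u` below by the weighted
  -- logarithms, each of mean `-constC1`; the constant term contributes `log 1 = 0`.
  have low2 : -constC1 ≤ ∫ y, Real.log (u y) ∂(stdGaussianPi ι) := by
    set p : κ → ℝ := fun k => ∑ i, w k i ^ 2 with hp
    have hp0 : ∀ k, 0 ≤ p k := fun k => Finset.sum_nonneg fun _ _ => sq_nonneg _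
    set ℓ : κ → (ι → ℝ) → ℝ := fun k y => p k / (c + τ) * Real.log ((w k ⬝ᵥ y) ^ 2 / p k) with hℓ
    have hi : ∀ k, Integrable (ℓ k) (stdGaussianPi ι) ∧
        ∫ y, ℓ k y ∂(stdGaussianPi ι) = p k / (c + τ) * -constC1 ∧
        ∀ᵐ y ∂(stdGaussianPi ι), p k ≠ 0 → w k ⬝ᵥ y ≠ 0 := by
      intro k
      rcases (hp0 k).eq_or_lt with h | h
      · simp [hℓ, ← h]
      · obtain ⟨h1, h2, h3⟩ := integral_log_dotProduct_sq h
        refine ⟨h2.const_mul _, ?_, ?_⟩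
        · simp only [hℓ]
          rw [integral_const_mul, h3]
        · filter_upwards [h1] with y hy _ using hy
    have hae : ∀ᵐ y ∂(stdGaussianPi ι), ∑ k, ℓ k y ≤ Real.log (u y) := by
      filter_upwards [ae_all_iff.2 fun k => (hi k).2.2] with y hy
      -- Concavity in tangent form: `log (z/u) ≤ z/u - 1`, multiplied by the weight of `z`.
      have h1 : ∀ k, ℓ k y ≤ p k / (c + τ) * Real.log (u y)
          + ((w k ⬝ᵥ y) ^ 2 / (c + τ) / u y - p k / (c + τ)) := by
        intro k
        rcases (hp0 k).eq_or_lt with h | h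
        · simp only [hℓ, ← h]
          simp only [zero_div, zero_mul, sub_zero, zero_add]
          have := hu0 y
          positivity
        · have hz : 0 < (w k ⬝ᵥ y) ^ 2 / p k := by
            have := hy k h.ne'
            positivity
          have h2 := Real.log_le_sub_one_of_pos (div_pos hz (hu0 y))
          rw [Real.log_div hz.ne' (hu0 y).ne'] at h2
          have h3 := mul_le_mul_of_nonneg_left h2 (div_pos h hZ).le
          have h4 : p k / (c + τ) * ((w k ⬝ᵥ y) ^ 2 / p k / u y - 1)
              = (w k ⬝ᵥ y) ^ 2 / (c + τ) / u y - p k / (c + τ) := by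
            have := (hu0 y).ne'
            field_simp
          rw [h4] at h3
          simp only [hℓ]
          linarith
      have h2 := Finset.sum_le_sum fun k (_ : k ∈ Finset.univ) => h1 k
      rw [Finset.sum_add_distrib, Finset.sum_sub_distrib, ← Finset.sum_mul, ← Finset.sum_div,
        ← Finset.sum_div, ← Finset.sum_div] at h2
      have h3 : ∑ k, p k = τ := rfl
      have h4 : ∑ k, (w k ⬝ᵥ y) ^ 2 = sumSq w y := rfl
      rw [h3, h4] at h2
      have h5 := Real.one_sub_inv_le_log_of_pos (hu0 y)
      have h6 : sumSq w y / (c + τ) / u y = 1 - c / (c + τ) * (u y)⁻¹ := by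
        have := (hcq y).ne'
        simp only [hu]
        field_simp
        ring
      have h7 : τ / (c + τ) = 1 - c / (c + τ) := by field_simp; ring
      have h8 := mul_le_mul_of_nonneg_left h5 (div_pos hc hZ).le
      rw [h6, h7] at h2
      linarith
    have h1 : ∫ y, ∑ k, ℓ k y ∂(stdGaussianPi ι) ≤ ∫ y, Real.log (u y) ∂(stdGaussianPi ι) :=
      integral_mono_ae (integrable_finsetSum _ fun k _ => (hi k).1) ilog hae
    rw [integral_finsetSum _ fun k _ => (hi k).1, Finset.sum_congr rfl fun k _ => (hi k).2.1,
      ← Finset.sum_mul, ← Finset.sum_div] at h1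
    -- The weights of the squares total at most `1`; as `constC1 ≥ 0`, the loss is at most
    -- `constC1`.
    have h2 : (∑ k, p k) / (c + τ) ≤ 1 := by
      rw [div_le_one hZ]
      exact le_add_of_nonneg_left hc.le
    nlinarith [constC1_nonneg]
  refine ⟨ilog, up, ?_, ?_⟩
  · rcases min_cases (b / 2) constC1 with h | h <;> rw [h.1] <;> assumption
  -- `|log u| ≤ 2u - log u` and `E u = 1`. The resulting bound depends neither on `c` nor on `w`, as
  -- Fubini requires later.
  · have : ∫ y, ‖Real.log (u y)‖ ∂(stdGaussianPi ι)
        ≤ ∫ y, (2 * u y - Real.log (u y)) ∂(stdGaussianPi ι) := by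
      refine integral_mono ilog.norm ((iu.const_mul 2).sub ilog) fun y => ?_
      have h1 := Real.log_le_sub_one_of_pos (hu0 y)
      have h5 := hu0 y
      rw [Real.norm_eq_abs, abs_le]
      constructor <;> linarith
    rw [integral_sub (iu.const_mul 2) ilog, integral_const_mul, Eu] at this
    linarith

end QuadraticForm

/-- A decomposition into rank-one matrices `v vᵀ` makes the Gaussian estimates available for an
arbitrary positive semidefinite form. -/
theorem exists_sumSq_eq_of_posSemidef {n : Type*} [Fintype n] {Q : Matrix n n ℝ} (hQ : Q.PosSemidef) :
    ∃ (m : ℕ) (w : Fin m → n → ℝ), (∀ y, sumSq w y = y ⬝ᵥ (Q.mulVec y)) ∧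
      ∑ k, ∑ i, w k i ^ 2 = Q.trace := by
  obtain ⟨m, w, rfl⟩ := Matrix.posSemidef_iff_eq_sum_vecMulVec.1 hQ
  refine ⟨m, w, fun y => ?_, ?_⟩
  · rw [Matrix.sum_mulVec, dotProduct_sum]
    refine Finset.sum_congr rfl fun k _ => ?_
    rw [Matrix.vecMulVec_mulVec]
    simp [dotProduct_smul, dotProduct_comm, sq]
  · rw [Matrix.trace_sum]
    refine Finset.sum_congr rfl fun k _ => ?_
    simp [Matrix.trace_vecMulVec, dotProduct, sq]

/-! ### Principal minors of a scalar matrix plus a skew matrix. -/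

section Mask

variable {n : Type*} [DecidableEq n]

/-- The matrix that agrees with `M` on `T × T` and with the identity elsewhere; its determinant is
the principal minor of `M` on `T`. -/
def principalMask (M : Matrix n n ℝ) (T : Finset n) : Matrix n n ℝ :=
  Matrix.of fun i j => if i ∈ T ∧ j ∈ T then M i j else if i = j then 1 else 0

theorem principalMask_apply (M : Matrix n n ℝ) (T : Finset n) (i j : n) :
    principalMask M T i j = if i ∈ T ∧ j ∈ T then M i j else if i = j then 1 else 0 := rfl

theorem principalMask_empty (M : Matrix n n ℝ) : principalMask M ∅ = 1 := by
  ext i j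
  simp [principalMask_apply, Matrix.one_apply]

theorem principalMask_congr {M M' : Matrix n n ℝ} {T : Finset n}
    (h : ∀ i ∈ T, ∀ j ∈ T, M i j = M' i j) : principalMask M T = principalMask M' T := by
  ext i j
  simp only [principalMask_apply]
  split_ifs with h1
  · exact h i h1.1 j h1.2
  · rfl
  · rfl

variable [Fintype n]

theorem principalMask_univ (M : Matrix n n ℝ) : principalMask M Finset.univ = M := by
  ext i j
  simp [principalMask_apply]

/-- Erasing `j` turns both row `j` and column `j` into a unit vector; replacing the row alone
already gives the cofactor. -/
theorem det_principalMask_erase (M : Matrix n n ℝ) (T : Finset n) (j : n) :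
    (principalMask M (T.erase j)).det = (principalMask M T).adjugate j j := by
  have h : principalMask M (T.erase j) = ((principalMask M T).updateRow j (Pi.single j 1)).updateCol j
      (Pi.single j 1) := by
    ext a b
    by_cases ha : a = j
    · by_cases hb : b = j
      · simp [principalMask_apply, ha, hb]
      · simp [principalMask_apply, ha, hb, Ne.symm hb]
    · by_cases hb : b = j
      · simp [principalMask_apply, ha, hb]
      · simp [principalMask_apply, Matrix.updateRow_apply, ha, hb]
  rw [h, ← Matrix.det_transpose, ← Matrix.updateRow_transpose, ← Matrix.adjugate_apply,
    ← Matrix.adjugate_transpose, Matrix.transpose_apply, Matrix.adjugate_apply,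
    Matrix.updateRow_idem, Matrix.adjugate_apply]

variable {M : Matrix n n ℝ} {s : ℝ}

theorem vecMul_inv_support {T : Finset n} (hB : (principalMask M T).det ≠ 0) {v : n → ℝ}
    (hv : ∀ j ∉ T, v j = 0) {j : n} (hj : j ∉ T) :
    Matrix.vecMul v (principalMask M T)⁻¹ j = 0 := by
  set w := Matrix.vecMul v (principalMask M T)⁻¹ with hw
  have h1 : Matrix.vecMul w (principalMask M T) = v := by
    rw [hw, Matrix.vecMul_vecMul, Matrix.nonsing_inv_mul _ (isUnit_iff_ne_zero.2 hB),
      Matrix.vecMul_one]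
  have h2 : Matrix.vecMul w (principalMask M T) j = w j := by
    simp [Matrix.vecMul, dotProduct, principalMask_apply, hj]
  rw [← h2, h1, hv j hj]

/-- With `w = v B⁻¹` the left side is `w B wᵀ`, in which the skew part cancels. As `w` vanishes off
`T`, the diagonal entries `1` there do not interfere with `s`. -/
theorem vecMul_inv_dotProduct (hdiag : ∀ i, M i i = s) (hskew : ∀ i j, i ≠ j → M j i = -M i j)
    {T : Finset n} (hB : (principalMask M T).det ≠ 0) {v : n → ℝ} (hv : ∀ j ∉ T, v j = 0) :
    Matrix.vecMul v (principalMask M T)⁻¹ ⬝ᵥ v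
      = s * ∑ i, Matrix.vecMul v (principalMask M T)⁻¹ i ^ 2 := by
  have hsup := fun j (hj : j ∉ T) => vecMul_inv_support hB hv hj
  set w := Matrix.vecMul v (principalMask M T)⁻¹ with hw
  have h1 : Matrix.vecMul w (principalMask M T) = v := by
    rw [hw, Matrix.vecMul_vecMul, Matrix.nonsing_inv_mul _ (isUnit_iff_ne_zero.2 hB),
      Matrix.vecMul_one]
  have h2 : w ⬝ᵥ v = ∑ i, ∑ j, w i * w j * principalMask M T i j := by
    conv_lhs => rw [← h1]
    simp only [dotProduct, Matrix.vecMul, Finset.mul_sum]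
    rw [Finset.sum_comm]
    exact Finset.sum_congr rfl fun i _ => Finset.sum_congr rfl fun j _ => by ring
  have h3 : w ⬝ᵥ v = ∑ i, ∑ j, w i * w j * principalMask M T j i := by
    rw [h2, Finset.sum_comm]
    exact Finset.sum_congr rfl fun i _ => Finset.sum_congr rfl fun j _ => by ring
  have h4 : w ⬝ᵥ v + w ⬝ᵥ v = ∑ i, 2 * (s * w i ^ 2) := by
    conv_lhs => enter [2]; rw [h3]
    rw [h2, ← Finset.sum_add_distrib]
    refine Finset.sum_congr rfl fun i _ => ?_
    rw [← Finset.sum_add_distrib, Finset.sum_eq_single i]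
    · by_cases hi : i ∈ T
      · simp [principalMask_apply, hi, hdiag]
        ring
      · simp [hsup i hi]
    · intro j _ hj
      by_cases hij : i ∈ T ∧ j ∈ T
      · simp [principalMask_apply, hij.1, hij.2, hskew i j (Ne.symm hj)]
      · rcases not_and_or.1 hij with h | h
        · simp [hsup i h]
        · simp [hsup j h]
    · simp
  rw [← Finset.mul_sum, ← Finset.mul_sum] at h4
  linarith

/-- Expansion of a bordered determinant. -/
theorem det_principalMask_eq (hdiag : ∀ i, M i i = s) (hskew : ∀ i j, i ≠ j → M j i = -M i j)
    {T : Finset n} {k : n} (hk : k ∈ T) (hB : (principalMask M (T.erase k)).det ≠ 0) {v : n → ℝ}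
    (hv : ∀ j, v j = if j ∈ T.erase k then M k j else 0) :
    (principalMask M T).det = (s + Matrix.vecMul v (principalMask M (T.erase k))⁻¹ ⬝ᵥ v)
      * (principalMask M (T.erase k)).det := by
  have hv0 : ∀ j ∉ T.erase k, v j = 0 := fun j hj => by rw [hv, if_neg hj]
  have hsup := fun j (hj : j ∉ T.erase k) => vecMul_inv_support hB hv0 hj
  set w := Matrix.vecMul v (principalMask M (T.erase k))⁻¹ with hw
  have h1 : Matrix.vecMul w (principalMask M (T.erase k)) = v := by
    rw [hw, Matrix.vecMul_vecMul, Matrix.nonsing_inv_mul _ (isUnit_iff_ne_zero.2 hB),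
      Matrix.vecMul_one]
  have hwk : w k = 0 := hsup k (Finset.notMem_erase k T)
  -- Coefficients of the row operation that subtracts `∑ w i • row i` from row `k`. By skewness it
  -- turns row `k` into `(s + w ⬝ᵥ v)` times a unit vector.
  set c : n → ℝ := Function.update (-w) k 1 with hc
  have hsum : ∀ f : n → ℝ, ∑ i, c i * f i = f k - ∑ i, w i * f i := by
    intro f
    rw [← Finset.add_sum_erase _ _ (Finset.mem_univ k),
      ← Finset.add_sum_erase _ (fun i => w i * f i) (Finset.mem_univ k), hwk, hc,
      Function.update_self, one_mul, zero_mul, zero_add, sub_eq_add_neg, ← Finset.sum_neg_distrib]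
    congr 1
    refine Finset.sum_congr rfl fun i hi => ?_
    rw [Function.update_of_ne (Finset.ne_of_mem_erase hi)]
    simp
  have hrow : ∑ i, c i • principalMask M T i = (s + w ⬝ᵥ v) • (Pi.single k 1 : n → ℝ) := by
    ext j
    rw [Finset.sum_apply]
    simp only [Pi.smul_apply, smul_eq_mul]
    rw [hsum fun i => principalMask M T i j]
    by_cases hj : j = k
    · subst hj
      rw [Pi.single_eq_same, mul_one, principalMask_apply, if_pos ⟨hk, hk⟩, hdiag, sub_eq_add_neg,
        ← Finset.sum_neg_distrib]
      congr 1
      refine Finset.sum_congr rfl fun i _ => ?_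
      by_cases hi : i ∈ T.erase j
      · have hne := Finset.ne_of_mem_erase hi
        rw [principalMask_apply, if_pos ⟨Finset.mem_of_mem_erase hi, hk⟩, hv, if_pos hi,
          hskew j i (Ne.symm hne)]
        ring
      · simp [hsup i hi]
    · rw [Pi.single_eq_of_ne hj, mul_zero, sub_eq_zero]
      have h2 : ∑ i, w i * principalMask M T i j = v j := by
        conv_rhs => rw [← h1]
        refine Finset.sum_congr rfl fun i _ => ?_
        by_cases hi : i = k
        · rw [hi, hwk]; simp
        · simp [principalMask_apply, hi, hj]
      rw [h2, hv]
      simp [principalMask_apply, hk, hj, Ne.symm hj]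
  have key := Matrix.det_updateRow_sum (principalMask M T) k c
  rw [hrow, Matrix.det_updateRow_smul, ← Matrix.adjugate_apply, ← det_principalMask_erase, hc,
    Function.update_self, one_smul] at key
  exact key.symm

/-- Each added index multiplies the determinant by `s + s |w|² > 0`. -/
theorem det_principalMask_pos (hs : 0 < s) (hdiag : ∀ i, M i i = s)
    (hskew : ∀ i j, i ≠ j → M j i = -M i j) (T : Finset n) : 0 < (principalMask M T).det := by
  induction T using Finset.induction_on with
  | empty => simp [principalMask_empty]
  | insert k T hk ih =>
    have he : (insert k T).erase k = T := Finset.erase_insert hk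
    rw [det_principalMask_eq hdiag hskew (Finset.mem_insert_self k T) (by rw [he]; exact ih.ne')
      fun j => rfl, he,
      vecMul_inv_dotProduct hdiag hskew ih.ne' fun j hj => by rw [if_neg hj]]
    positivity

/-- The quadratic form of the adjugate of a principal minor. -/
theorem adjugate_form_eq (hs : 0 < s) (hdiag : ∀ i, M i i = s)
    (hskew : ∀ i j, i ≠ j → M j i = -M i j) (T : Finset n) (v : n → ℝ) :
    v ⬝ᵥ ((principalMask M T).adjugate.mulVec v)
      = (principalMask M T).det * (Matrix.vecMul v (principalMask M T)⁻¹ ⬝ᵥ v) := by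
  have h := (det_principalMask_pos hs hdiag hskew T).ne'
  rw [Matrix.inv_def, Matrix.vecMul_smul, smul_dotProduct, smul_eq_mul, Ring.inverse_eq_inv',
    mul_inv_cancel_left₀ h, Matrix.dotProduct_mulVec]

theorem adjugate_form_nonneg (hs : 0 < s) (hdiag : ∀ i, M i i = s)
    (hskew : ∀ i j, i ≠ j → M j i = -M i j) (T : Finset n) {v : n → ℝ} (hv : ∀ j ∉ T, v j = 0) :
    0 ≤ v ⬝ᵥ ((principalMask M T).adjugate.mulVec v) := by
  have h := det_principalMask_pos hs hdiag hskew T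
  rw [adjugate_form_eq hs hdiag hskew, vecMul_inv_dotProduct hdiag hskew h.ne' hv]
  positivity

/-- With `w = v B⁻¹`, the identity `s |w|² = w ⬝ᵥ v` and Cauchy–Schwarz give `s |w| ≤ |v|`, hence `w
⬝ᵥ v ≤ |v|²/s`. -/
theorem adjugate_form_le (hs : 0 < s) (hdiag : ∀ i, M i i = s)
    (hskew : ∀ i j, i ≠ j → M j i = -M i j) (T : Finset n) {v : n → ℝ} (hv : ∀ j ∉ T, v j = 0) :
    v ⬝ᵥ ((principalMask M T).adjugate.mulVec v)
      ≤ (principalMask M T).det / s * ∑ j, v j ^ 2 := by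
  have h := det_principalMask_pos hs hdiag hskew T
  rw [adjugate_form_eq hs hdiag hskew, div_mul_eq_mul_div, mul_div_assoc]
  refine mul_le_mul_of_nonneg_left ?_ h.le
  have h1 := vecMul_inv_dotProduct hdiag hskew h.ne' hv
  set w := Matrix.vecMul v (principalMask M T)⁻¹
  have h2 : (w ⬝ᵥ v) ^ 2 ≤ (∑ i, w i ^ 2) * ∑ i, v i ^ 2 := Finset.sum_mul_sq_le_sq_mul_sq _ _ _
  have h3 : 0 ≤ ∑ i, w i ^ 2 := by positivity
  have h4 : 0 ≤ ∑ i, v i ^ 2 := by positivity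
  rw [le_div_iff₀ hs]
  rcases h3.eq_or_lt with h5 | h5
  · rw [h1, ← h5]; simpa using h4
  · rw [h1] at h2 ⊢
    have h6 : (∑ i, w i ^ 2) * (s * (∑ i, w i ^ 2) * s) ≤ (∑ i, w i ^ 2) * ∑ i, v i ^ 2 := by
      nlinarith
    exact le_of_mul_le_mul_left h6 h5

end Mask

/-! ### Weighted matching sums and their recurrence. -/

section Matching

variable {V : Type*} [Fintype V]

open Classical in
/-- The matchings of `G` all of whose edges lie in `T`. -/
noncomputable def matchingsIn (G : SimpleGraph V) (T : Finset V) : Finset (Finset (Sym2 V)) :=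
  Finset.univ.filter fun M => IsMatchingSet G M ∧ ∀ e ∈ M, ∀ v ∈ e, v ∈ T

/-- The sum over the matchings `M` inside `T` of the product of the weights times `s` to the number
of the vertices of `T` that `M` leaves uncovered. -/
noncomputable def matchingSum (G : SimpleGraph V) (w : Sym2 V → ℝ) (s : ℝ) (T : Finset V) : ℝ :=
  ∑ M ∈ matchingsIn G T, (∏ e ∈ M, w e) * s ^ ((T.card : ℤ) - 2 * M.card)

variable {G : SimpleGraph V} {w : Sym2 V → ℝ} {s : ℝ}

theorem mem_matchingsIn {T : Finset V} {M : Finset (Sym2 V)} :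
    M ∈ matchingsIn G T ↔ IsMatchingSet G M ∧ ∀ e ∈ M, ∀ v ∈ e, v ∈ T := by
  simp [matchingsIn]

theorem matchingSum_empty : matchingSum G w s ∅ = 1 := by
  have : matchingsIn G ∅ = {∅} := by
    ext M
    rw [mem_matchingsIn, Finset.mem_singleton]
    constructor
    · rintro ⟨-, h⟩
      rw [Finset.eq_empty_iff_forall_notMem]
      intro e he
      induction e using Sym2.ind with
      | _ a b => simpa using h _ he a (Sym2.mem_mk_left a b)
    · rintro rfl
      simp [IsMatchingSet]
  simp [matchingSum, this]

theorem matchingSum_pos (hs : 0 < s) (hw : ∀ e, 0 ≤ w e) (T : Finset V) :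
    0 < matchingSum G w s T := by
  refine Finset.sum_pos' (fun M _ => mul_nonneg (Finset.prod_nonneg fun e _ => hw e)
    (zpow_pos hs _).le) ⟨∅, by simp [mem_matchingsIn, IsMatchingSet], ?_⟩
  simpa using pow_pos hs T.card

variable [DecidableEq V]

open Classical in
theorem filter_uncovered_matchingsIn {T : Finset V} {k : V} :
    (matchingsIn G T).filter (fun M => ¬∃ e ∈ M, k ∈ e) = matchingsIn G (T.erase k) := by
  ext M
  simp only [Finset.mem_filter, mem_matchingsIn, Finset.mem_erase, not_exists, not_and]
  constructor
  · rintro ⟨⟨h1, h2⟩, h3⟩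
    exact ⟨h1, fun e he v hv => ⟨fun h => h3 e he (h ▸ hv), h2 e he v hv⟩⟩
  · rintro ⟨h1, h2⟩
    exact ⟨⟨h1, fun e he v hv => (h2 e he v hv).2⟩, fun e he hk => (h2 e he k hk).1 rfl⟩

/-- Removing the edge `s(k, j)` is a bijection onto the matchings that avoid both endpoints. It
takes away two vertices and one edge, so the power of `s` is unchanged. -/
theorem sum_matchingsIn_edge {T : Finset V} {k j : V} (hk : k ∈ T)
    (hj : j ∈ T.erase k) (hadj : G.Adj k j) :
    ∑ M ∈ (matchingsIn G T).filter (fun M => s(k, j) ∈ M),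
      (∏ e ∈ M, w e) * s ^ ((T.card : ℤ) - 2 * M.card)
      = w s(k, j) * matchingSum G w s ((T.erase k).erase j) := by
  have hjk : j ≠ k := Finset.ne_of_mem_erase hj
  have hjT : j ∈ T := Finset.mem_of_mem_erase hj
  have hnot : ∀ M ∈ matchingsIn G ((T.erase k).erase j), s(k, j) ∉ M := by
    intro M hM he
    have := (mem_matchingsIn.1 hM).2 _ he k (Sym2.mem_mk_left k j)
    simp at this
  have hcard : (T.card : ℤ) = ((T.erase k).erase j).card + 2 := by
    have h1 := Finset.card_erase_add_one hk
    have h2 := Finset.card_erase_add_one hj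
    omega
  rw [matchingSum, Finset.mul_sum]
  refine Finset.sum_nbij' (fun M => M.erase s(k, j)) (fun M => insert s(k, j) M) ?_ ?_ ?_ ?_ ?_
  · intro M hM
    rw [Finset.mem_filter, mem_matchingsIn] at hM
    obtain ⟨⟨⟨h1, h2⟩, h3⟩, h4⟩ := hM
    rw [mem_matchingsIn]
    refine ⟨⟨fun e he => h1 e (Finset.mem_of_mem_erase he), fun e he f hf =>
      h2 e (Finset.mem_of_mem_erase he) f (Finset.mem_of_mem_erase hf)⟩, fun e he v hv => ?_⟩
    have hne := Finset.ne_of_mem_erase he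
    have he' := Finset.mem_of_mem_erase he
    have hv' := h2 e he' _ h4 hne v hv
    rw [Sym2.mem_iff, not_or] at hv'
    exact Finset.mem_erase.2 ⟨hv'.2, Finset.mem_erase.2 ⟨hv'.1, h3 e he' v hv⟩⟩
  · intro M hM
    rw [mem_matchingsIn] at hM
    obtain ⟨⟨h1, h2⟩, h3⟩ := hM
    have hdis : ∀ e ∈ M, ∀ v ∈ e, v ∉ s(k, j) := by
      intro e he v hv hv'
      have := h3 e he v hv
      rcases Sym2.mem_iff.1 hv' with rfl | rfl <;> simp at this
    rw [Finset.mem_filter, mem_matchingsIn]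
    refine ⟨⟨⟨?_, ?_⟩, ?_⟩, Finset.mem_insert_self _ _⟩
    · intro e he
      rcases Finset.mem_insert.1 he with rfl | he
      · exact hadj
      · exact h1 e he
    · intro e he f hf hef v hv hvf
      rcases Finset.mem_insert.1 he with rfl | he <;> rcases Finset.mem_insert.1 hf with rfl | hf
      · exact hef rfl
      · exact hdis f hf v hvf hv
      · exact hdis e he v hv hvf
      · exact h2 e he f hf hef v hv hvf
    · intro e he v hv
      rcases Finset.mem_insert.1 he with rfl | he
      · rcases Sym2.mem_iff.1 hv with rfl | rfl
        · exact hk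
        · exact hjT
      · exact Finset.mem_of_mem_erase (Finset.mem_of_mem_erase (h3 e he v hv))
  · intro M hM
    exact Finset.insert_erase (Finset.mem_filter.1 hM).2
  · intro M hM
    exact Finset.erase_insert (hnot M hM)
  · intro M hM
    have h4 := (Finset.mem_filter.1 hM).2
    have h5 := Finset.card_erase_add_one h4
    rw [← Finset.mul_prod_erase _ _ h4, mul_assoc]
    congr 3
    omega

/-- Matchings are split according to whether `k` is uncovered or matched to some `j`. Zero weights
off the graph let the sum run over all `j`, as it does in `rowMean`. -/
theorem matchingSum_eq_erase (hs : s ≠ 0) {T : Finset V} {k : V} (hk : k ∈ T)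
    (hw : ∀ j, ¬G.Adj k j → w s(k, j) = 0) :
    matchingSum G w s T = s * matchingSum G w s (T.erase k)
      + ∑ j ∈ T.erase k, w s(k, j) * matchingSum G w s ((T.erase k).erase j) := by
  classical
  rw [matchingSum, ← Finset.sum_filter_not_add_sum_filter _ (fun M => ∃ e ∈ M, k ∈ e),
    filter_uncovered_matchingsIn]
  congr 1
  · rw [matchingSum, Finset.mul_sum]
    refine Finset.sum_congr rfl fun M _ => ?_
    have h1 := Finset.card_erase_add_one hk
    have h2 : (T.card : ℤ) - 2 * M.card = 1 + (((T.erase k).card : ℤ) - 2 * M.card) := by omega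
    rw [h2, zpow_add₀ hs, zpow_one]
    ring
  · have h1 : ∀ M ∈ (matchingsIn G T).filter (fun M => ∃ e ∈ M, k ∈ e),
        (∏ e ∈ M, w e) * s ^ ((T.card : ℤ) - 2 * M.card) = ∑ j ∈ T.erase k,
          if s(k, j) ∈ M then (∏ e ∈ M, w e) * s ^ ((T.card : ℤ) - 2 * M.card) else 0 := by
      intro M hM
      rw [Finset.mem_filter, mem_matchingsIn] at hM
      obtain ⟨⟨⟨h1, h2⟩, h3⟩, e, he, hke⟩ := hM
      obtain ⟨j, rfl⟩ := Sym2.mem_iff_exists.1 hke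
      have hadj : G.Adj k j := h1 _ he
      rw [Finset.sum_eq_single j, if_pos he]
      · intro i _ hij
        rw [if_neg]
        intro hi
        refine h2 _ hi _ he ?_ k (Sym2.mem_mk_left k i) (Sym2.mem_mk_left k j)
        rw [Ne, Sym2.congr_right]
        exact hij
      · intro hj
        exact absurd (Finset.mem_erase.2 ⟨hadj.ne', h3 _ he j (Sym2.mem_mk_right k j)⟩) hj
    rw [Finset.sum_congr rfl h1, Finset.sum_comm]
    refine Finset.sum_congr rfl fun j hj => ?_
    rw [← Finset.sum_filter, Finset.filter_filter]
    have h2 : (matchingsIn G T).filter (fun M => (∃ e ∈ M, k ∈ e) ∧ s(k, j) ∈ M)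
        = (matchingsIn G T).filter (fun M => s(k, j) ∈ M) :=
      Finset.filter_congr fun M _ =>
        ⟨fun h => h.2, fun h => ⟨⟨_, h, Sym2.mem_mk_left k j⟩, h⟩⟩
    rw [h2]
    by_cases hadj : G.Adj k j
    · exact sum_matchingsIn_edge hk hj hadj
    · rw [hw j hadj, zero_mul]
      refine Finset.sum_eq_zero fun M hM => ?_
      rw [Finset.mem_filter, mem_matchingsIn] at hM
      exact absurd (hM.1.1.1 _ hM.2) hadj

theorem two_mul_card_le_of_isMatchingSet {M : Finset (Sym2 V)} (hM : IsMatchingSet G M) :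
    2 * M.card ≤ Fintype.card V := by
  have h1 : (M.biUnion Sym2.toFinset).card = ∑ e ∈ M, e.toFinset.card := by
    refine Finset.card_biUnion fun e he f hf hef => ?_
    rw [Function.onFun, Finset.disjoint_left]
    intro v hv hv'
    exact hM.2 e he f hf hef v (Sym2.mem_toFinset.1 hv) (Sym2.mem_toFinset.1 hv')
  have h2 : ∑ e ∈ M, e.toFinset.card = ∑ e ∈ M, 2 :=
    Finset.sum_congr rfl fun e he => Sym2.card_toFinset_of_not_isDiag e
      (G.not_isDiag_of_mem_edgeSet (hM.1 e he))
  rw [Finset.sum_const, smul_eq_mul] at h2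
  have h3 := Finset.card_le_univ (M.biUnion Sym2.toFinset)
  omega

/-- A `k`-matching leaves `#V - 2k` vertices uncovered, which is the parity of `#V` plus `2 (⌊#V/2⌋
- k)`; the parity produces the extra `√t` for odd `#V`. -/
theorem matchingSum_univ {t : ℝ} (ht : 0 < t) :
    matchingSum G w √t Finset.univ = √t ^ (Fintype.card V % 2) * matchingPoly G w t := by
  classical
  have hmaps : ∀ M ∈ matchingsIn G Finset.univ,
      M.card ∈ Finset.range (Fintype.card V / 2 + 1) := by
    intro M hM
    have := two_mul_card_le_of_isMatchingSet (mem_matchingsIn.1 hM).1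
    rw [Finset.mem_range]
    omega
  rw [matchingSum, ← Finset.sum_fiberwise_of_maps_to hmaps, matchingPoly, Finset.mul_sum]
  refine Finset.sum_congr rfl fun k hk => ?_
  have hk' := Finset.mem_range.1 hk
  have h1 : (matchingsIn G Finset.univ).filter (fun M => M.card = k) = kMatchings G k := by
    ext M
    simp [mem_matchingsIn, kMatchings]
  rw [h1, totalMatching, Finset.sum_mul, Finset.mul_sum]
  refine Finset.sum_congr rfl fun M hM => ?_
  have h2 : M.card = k := by
    rw [kMatchings, Finset.mem_filter] at hM
    exact hM.2.2
  have h3 : ((Finset.univ : Finset V).card : ℤ) - 2 * M.card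
      = ((Fintype.card V % 2 + 2 * (Fintype.card V / 2 - k) : ℕ) : ℤ) := by
    rw [Finset.card_univ, h2]
    omega
  rw [h3, zpow_natCast, pow_add, pow_mul, Real.sq_sqrt ht.le]
  ring

end Matching

/-! ### Symmetrized quadratic forms. -/

section SymForm

variable {n : Type*}

/-- The symmetric matrix of the quadratic form `y ↦ (d y)ᵀ B (d y)`. -/
noncomputable def symForm (d : n → ℝ) (B : Matrix n n ℝ) : Matrix n n ℝ :=
  Matrix.of fun i j => d i * d j * (B i j + B j i) / 2

variable [Fintype n]

theorem dotProduct_symForm_mulVec (d : n → ℝ) (B : Matrix n n ℝ) (y : n → ℝ) :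
    y ⬝ᵥ ((symForm d B).mulVec y) = (d * y) ⬝ᵥ (B.mulVec (d * y)) := by
  have h : (d * y) ⬝ᵥ (B.mulVec (d * y)) = ∑ i, ∑ j, d i * y i * (B i j * (d j * y j)) := by
    simp [dotProduct, Matrix.mulVec, Finset.mul_sum]
  have h' : (d * y) ⬝ᵥ (B.mulVec (d * y)) = ∑ i, ∑ j, d i * y i * (B j i * (d j * y j)) := by
    rw [h, Finset.sum_comm]
    exact Finset.sum_congr rfl fun i _ => Finset.sum_congr rfl fun j _ => by ring
  have h2 : y ⬝ᵥ ((symForm d B).mulVec y)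
      = ((∑ i, ∑ j, d i * y i * (B i j * (d j * y j)))
        + ∑ i, ∑ j, d i * y i * (B j i * (d j * y j))) / 2 := by
    simp only [dotProduct, Matrix.mulVec, symForm, Matrix.of_apply, Finset.mul_sum]
    rw [← Finset.sum_add_distrib, Finset.sum_div]
    refine Finset.sum_congr rfl fun i _ => ?_
    rw [← Finset.sum_add_distrib, Finset.sum_div]
    exact Finset.sum_congr rfl fun j _ => by ring
  rw [h2, ← h, ← h']
  ring

theorem trace_symForm (d : n → ℝ) (B : Matrix n n ℝ) :
    (symForm d B).trace = ∑ j, d j ^ 2 * B j j := by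
  refine Finset.sum_congr rfl fun j _ => ?_
  simp [symForm]
  ring

theorem posSemidef_symForm {d : n → ℝ} {B : Matrix n n ℝ}
    (h : ∀ y, 0 ≤ (d * y) ⬝ᵥ (B.mulVec (d * y))) : (symForm d B).PosSemidef := by
  refine Matrix.PosSemidef.of_dotProduct_mulVec_nonneg ?_ fun y => ?_
  · ext i j
    simp [symForm]
    ring
  · rw [star_trivial, dotProduct_symForm_mulVec]
    exact h y

end SymForm

/-! ### Averaging out a single row. -/

variable {N : ℕ}

/-- The matrix `s I + Y` in the variables `z`, of which only the upper triangle matters. -/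
def shiftedSample (A : Matrix (Fin N) (Fin N) ℝ) (s : ℝ) (z : Fin N → Fin N → ℝ) :
    Matrix (Fin N) (Fin N) ℝ :=
  Matrix.of fun i j => if i = j then s else A i j * z (min i j) (max i j)

/-- The principal minor of `s I + Y` on `T`. -/
noncomputable def sampleMinor (A : Matrix (Fin N) (Fin N) ℝ) (s : ℝ) (T : Finset (Fin N))
    (z : Fin N → Fin N → ℝ) : ℝ :=
  (principalMask (shiftedSample A s z) T).det

/-- The conditional expectation of the minors given all rows but row `k`. -/
def rowMean (A : Matrix (Fin N) (Fin N) ℝ) (s : ℝ) (k : Fin N) (g : Finset (Fin N) → ℝ)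
    (T : Finset (Fin N)) : ℝ :=
  if k ∈ T then s * g (T.erase k) + ∑ j ∈ T.erase k, A k j ^ 2 * g ((T.erase k).erase j) else g T

/-- The transpose of `rowMean`, acting on coefficient vectors. -/
def rowMeanCoeff (A : Matrix (Fin N) (Fin N) ℝ) (s : ℝ) (k : Fin N) (c : Finset (Fin N) → ℝ)
    (U : Finset (Fin N)) : ℝ :=
  ∑ T, c T * rowMean A s k (fun W => if W = U then 1 else 0) T

variable {A : Matrix (Fin N) (Fin N) ℝ} {s : ℝ}

theorem shiftedSample_diag (z : Fin N → Fin N → ℝ) (i : Fin N) : shiftedSample A s z i i = s := by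
  simp [shiftedSample]

theorem shiftedSample_skew (hA : A.transpose = -A) (z : Fin N → Fin N → ℝ) (i j : Fin N)
    (hij : i ≠ j) : shiftedSample A s z j i = -shiftedSample A s z i j := by
  have h1 : A j i = -A i j := congrFun (congrFun hA i) j
  simp [shiftedSample, hij, hij.symm, h1, min_comm j i, max_comm j i]

theorem sampleMinor_pos (hA : A.transpose = -A) (hs : 0 < s) (T : Finset (Fin N))
    (z : Fin N → Fin N → ℝ) : 0 < sampleMinor A s T z :=
  det_principalMask_pos hs (shiftedSample_diag z) (shiftedSample_skew hA z) T

theorem continuous_sampleMinor (T : Finset (Fin N)) : Continuous (sampleMinor A s T) := by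
  unfold sampleMinor
  refine Continuous.matrix_det (continuous_matrix fun i j => ?_)
  simp only [principalMask_apply, shiftedSample, Matrix.of_apply]
  split_ifs <;> fun_prop

/-- This duality is used twice: with `g` the minors it identifies the mean over row `k`, and with
`g` the matching sums it shows that their combination is preserved. -/
theorem sum_rowMeanCoeff_mul (k : Fin N) (c g : Finset (Fin N) → ℝ) :
    ∑ U, rowMeanCoeff A s k c U * g U = ∑ T, c T * rowMean A s k g T := by
  simp only [rowMeanCoeff, Finset.sum_mul]
  rw [Finset.sum_comm]
  refine Finset.sum_congr rfl fun T _ => ?_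
  simp only [mul_assoc, ← Finset.mul_sum]
  congr 1
  unfold rowMean
  split_ifs with h
  · simp only [add_mul, Finset.sum_add_distrib, Finset.sum_mul]
    congr 1
    · simp
    · rw [Finset.sum_comm]
      refine Finset.sum_congr rfl fun j _ => ?_
      simp
  · simp

theorem rowMean_nonneg (hs : 0 < s) (k : Fin N) {g : Finset (Fin N) → ℝ} (hg : ∀ T, 0 ≤ g T)
    (T : Finset (Fin N)) : 0 ≤ rowMean A s k g T := by
  unfold rowMean
  split_ifs
  · exact add_nonneg (mul_nonneg hs.le (hg _))
      (Finset.sum_nonneg fun j _ => mul_nonneg (sq_nonneg _) (hg _))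
  · exact hg T

theorem rowMean_pos (hs : 0 < s) (k : Fin N) {g : Finset (Fin N) → ℝ} (hg : ∀ T, 0 < g T)
    (T : Finset (Fin N)) : 0 < rowMean A s k g T := by
  unfold rowMean
  split_ifs
  · exact add_pos_of_pos_of_nonneg (mul_pos hs (hg _))
      (Finset.sum_nonneg fun j _ => mul_nonneg (sq_nonneg _) (hg _).le)
  · exact hg T

theorem rowMeanCoeff_nonneg (hs : 0 < s) (k : Fin N) {c : Finset (Fin N) → ℝ}
    (hc : ∀ T, 0 ≤ c T) (U : Finset (Fin N)) : 0 ≤ rowMeanCoeff A s k c U :=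
  Finset.sum_nonneg fun T _ => mul_nonneg (hc T)
    (rowMean_nonneg hs k (fun W => by split_ifs <;> norm_num) T)

theorem sum_mul_pos {ι : Type*} [Fintype ι] {c g : ι → ℝ} (hc : ∀ i, 0 ≤ c i)
    (hc' : ∃ i, 0 < c i) (hg : ∀ i, 0 < g i) : 0 < ∑ i, c i * g i := by
  obtain ⟨i, hi⟩ := hc'
  exact Finset.sum_pos' (fun j _ => mul_nonneg (hc j) (hg j).le)
    ⟨i, Finset.mem_univ i, mul_pos hi (hg i)⟩

/-- Keeps the next combination strictly positive, so that its logarithm behaves. The proof tests the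
coefficients against `g = 1`. -/
theorem exists_rowMeanCoeff_pos (hs : 0 < s) (k : Fin N) {c : Finset (Fin N) → ℝ}
    (hc : ∀ T, 0 ≤ c T) (hc' : ∃ T, 0 < c T) : ∃ U, 0 < rowMeanCoeff A s k c U := by
  by_contra! h
  have h1 := sum_rowMeanCoeff_mul (A := A) (s := s) k c fun _ => 1
  have h2 := sum_mul_pos hc hc' (rowMean_pos (A := A) hs k (g := fun _ => 1) fun _ => one_pos)
  rw [← h1] at h2
  have h3 : ∑ U, rowMeanCoeff A s k c U * 1 ≤ 0 :=
    Finset.sum_nonpos fun U _ => by rw [mul_one]; exact h U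
  linarith

/-- Averaging only shrinks index sets and deletes `k` from those containing it, so support on
indices `≥ k` becomes support on indices `> k`. -/
theorem rowMeanCoeff_eq_zero (k : Fin N) {c : Finset (Fin N) → ℝ}
    (hsupp : ∀ T, (∃ i ∈ T, i < k) → c T = 0) {U : Finset (Fin N)} (hU : ∃ i ∈ U, i ≤ k) :
    rowMeanCoeff A s k c U = 0 := by
  obtain ⟨i, hiU, hik⟩ := hU
  refine Finset.sum_eq_zero fun T _ => ?_
  by_cases hT : ∃ i ∈ T, i < k
  · rw [hsupp T hT, zero_mul]
  have hne : ∀ W : Finset (Fin N), (k ∉ W) → W ⊆ T → W ≠ U := by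
    rintro W hk hWT rfl
    rcases hik.eq_or_lt with rfl | h
    · exact hk hiU
    · exact hT ⟨i, hWT hiU, h⟩
  have : rowMean A s k (fun W => if W = U then 1 else 0) T = 0 := by
    unfold rowMean
    split_ifs with h1
    · beta_reduce
      rw [if_neg (hne _ (Finset.notMem_erase k T) (Finset.erase_subset k T)), mul_zero, zero_add]
      refine Finset.sum_eq_zero fun j _ => ?_
      rw [if_neg (hne _ (fun h => Finset.notMem_erase k T (Finset.mem_of_mem_erase h))
        ((Finset.erase_subset _ _).trans (Finset.erase_subset k T))), mul_zero]
    · exact if_neg (hne T h1 subset_rfl)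
  rw [this, mul_zero]

/-- Row `k` enters a minor on indices `≥ k` through a quadratic form. -/
theorem sampleMinor_update (hA : A.transpose = -A) (hs : 0 < s) {k : Fin N} {T : Finset (Fin N)}
    (hT : ∀ i ∈ T, k ≤ i) (z : Fin N → Fin N → ℝ) (y : Fin N → ℝ) :
    sampleMinor A s T (Function.update z k y) =
      if k ∈ T then s * sampleMinor A s (T.erase k) z
        + y ⬝ᵥ ((symForm (fun j => if j ∈ T.erase k then A k j else 0)
          (principalMask (shiftedSample A s z) (T.erase k)).adjugate).mulVec y)
      else sampleMinor A s T z := by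
  have hrest : ∀ W : Finset (Fin N), k ∉ W → W ⊆ T →
      principalMask (shiftedSample A s (Function.update z k y)) W
        = principalMask (shiftedSample A s z) W := by
    intro W hk hW
    refine principalMask_congr fun i hi j hj => ?_
    -- Entry `(i, j)` is read from row `min i j` of `z`, so a minor that avoids `k` does not see row
    -- `k`.
    have h1 : min i j ≠ k := by
      rcases min_choice i j with h | h <;> rw [h] <;> rintro rfl <;> contradiction
    simp [shiftedSample, Function.update_of_ne h1]
  split_ifs with hk
  · have hr := hrest (T.erase k) (Finset.notMem_erase k T) (Finset.erase_subset k T)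
    set M := shiftedSample A s (Function.update z k y) with hM
    have hd : ∀ i, M i i = s := shiftedSample_diag _
    have hsk : ∀ i j, i ≠ j → M j i = -M i j := shiftedSample_skew hA _
    set d : Fin N → ℝ := fun j => if j ∈ T.erase k then A k j else 0 with hdd
    have hv : ∀ j, (d * y) j = if j ∈ T.erase k then M k j else 0 := by
      intro j
      simp only [Pi.mul_apply, hdd]
      split_ifs with hj
      · have h1 : k ≤ j := hT j (Finset.mem_of_mem_erase hj)
        have h2 : k ≠ j := (Finset.ne_of_mem_erase hj).symm
        simp [hM, shiftedSample, h2, min_eq_left h1, max_eq_right h1]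
      · rw [zero_mul]
    have hB := det_principalMask_pos hs hd hsk (T.erase k)
    rw [dotProduct_symForm_mulVec, sampleMinor, det_principalMask_eq hd hsk hk hB.ne' hv, ← hr,
      adjugate_form_eq hs hd hsk, sampleMinor, ← hr]
    ring
  · rw [sampleMinor, hrest T hk subset_rfl, sampleMinor]

/-- The logarithmic loss in averaging out one row. -/
theorem row_log_estimate (hA : A.transpose = -A) (hs : 0 < s) {a : ℝ} (ha : ∀ i j, |A i j| ≤ a)
    {k : Fin N} {c : Finset (Fin N) → ℝ} (hc : ∀ T, 0 ≤ c T) (hc' : ∃ T, 0 < c T)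
    (hsupp : ∀ T, (∃ i ∈ T, i < k) → c T = 0) (z : Fin N → Fin N → ℝ) :
    let u := fun y => Real.log ((∑ T, c T * sampleMinor A s T (Function.update z k y))
      / ∑ U, rowMeanCoeff A s k c U * sampleMinor A s U z)
    Integrable u (stdGaussianPi (Fin N)) ∧
    ∫ y, u y ∂(stdGaussianPi (Fin N)) ≤ 0 ∧
    -min (a ^ 2 / s ^ 2 / 2) constC1 ≤ ∫ y, u y ∂(stdGaussianPi (Fin N)) ∧
    ∫ y, ‖u y‖ ∂(stdGaussianPi (Fin N)) ≤ 2 + constC1 := by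
  intro u
  set M := shiftedSample A s z with hM
  have hd : ∀ i, M i i = s := shiftedSample_diag _
  have hsk : ∀ i j, i ≠ j → M j i = -M i j := shiftedSample_skew hA _
  set D : Finset (Fin N) → ℝ := fun T => sampleMinor A s T z with hD
  have hDpos : ∀ T, 0 < D T := fun T => sampleMinor_pos hA hs T z
  set e : Finset (Fin N) → Fin N → ℝ := fun T j => if j ∈ T.erase k then A k j else 0 with he
  have he0 : ∀ T (y : Fin N → ℝ), ∀ j ∉ T.erase k, (e T * y) j = 0 := by
    intro T y j hj
    simp only [Pi.mul_apply, he, if_neg hj, zero_mul]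
  have he1 : ∀ T j, e T j ^ 2 ≤ a ^ 2 := by
    intro T j
    simp only [he]
    split_ifs
    · exact sq_le_sq' (abs_le.1 (ha k j)).1 (abs_le.1 (ha k j)).2
    · simp [sq_nonneg]
  set B : Finset (Fin N) → Matrix (Fin N) (Fin N) ℝ :=
    fun T => (principalMask M (T.erase k)).adjugate with hBdef
  set c' : Finset (Fin N) → ℝ := fun T => if k ∈ T then c T else 0 with hc'def
  have hc'0 : ∀ T, 0 ≤ c' T := fun T => by
    simp only [hc'def]; split_ifs
    · exact hc T
    · exact le_rfl
  set Q : Matrix (Fin N) (Fin N) ℝ := ∑ T, c' T • symForm (e T) (B T) with hQ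
  have hQpsd : Q.PosSemidef := by
    refine Matrix.posSemidef_sum _ fun T _ => Matrix.PosSemidef.smul ?_ (hc'0 T)
    exact posSemidef_symForm fun y => adjugate_form_nonneg hs hd hsk _ (he0 T y)
  have hQform : ∀ y, y ⬝ᵥ (Q.mulVec y) = ∑ T, c' T * (y ⬝ᵥ ((symForm (e T) (B T)).mulVec y)) := by
    intro y
    rw [hQ, Matrix.sum_mulVec, dotProduct_sum]
    refine Finset.sum_congr rfl fun T _ => ?_
    rw [Matrix.smul_mulVec, dotProduct_smul, smul_eq_mul]
  have hQtr : Q.trace = ∑ T, c' T * ∑ j ∈ T.erase k, A k j ^ 2 * D ((T.erase k).erase j) := by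
    rw [hQ, Matrix.trace_sum]
    refine Finset.sum_congr rfl fun T _ => ?_
    rw [Matrix.trace_smul, smul_eq_mul, trace_symForm]
    congr 1
    rw [← Finset.sum_subset (Finset.subset_univ (T.erase k))]
    · refine Finset.sum_congr rfl fun j hj => ?_
      simp only [he, if_pos hj, hBdef, ← det_principalMask_erase, hD, sampleMinor, hM]
    · intro j _ hj
      simp only [he, if_neg hj]
      ring
  -- The part of the combination that does not involve row `k`.
  set c₀ : ℝ := ∑ T, c T * (if k ∈ T then s * D (T.erase k) else D T) with hc₀
  have hc₀pos : 0 < c₀ := sum_mul_pos hc hc' fun T => by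
    split_ifs
    · exact mul_pos hs (hDpos _)
    · exact hDpos T
  have hnum : ∀ y, ∑ T, c T * sampleMinor A s T (Function.update z k y)
      = c₀ + y ⬝ᵥ (Q.mulVec y) := by
    intro y
    rw [hQform, hc₀, ← Finset.sum_add_distrib]
    refine Finset.sum_congr rfl fun T _ => ?_
    by_cases hT : ∃ i ∈ T, i < k
    · simp [hsupp T hT, hc'def]
    · push Not at hT
      rw [sampleMinor_update hA hs hT]
      simp only [hc'def]
      split_ifs
      · ring
      · ring
  have hden : ∑ U, rowMeanCoeff A s k c U * sampleMinor A s U z = c₀ + Q.trace := by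
    rw [sum_rowMeanCoeff_mul k c D, hQtr, hc₀, ← Finset.sum_add_distrib]
    refine Finset.sum_congr rfl fun T _ => ?_
    simp only [rowMean, hc'def]
    split_ifs
    · ring
    · ring
  have hbound : ∀ y : Fin N → ℝ, y ⬝ᵥ (Q.mulVec y) ≤ a ^ 2 / s ^ 2 * c₀ * ∑ i, y i ^ 2 := by
    intro y
    have hy0 : 0 ≤ ∑ i, y i ^ 2 := by positivity
    -- Each form is at most `D (T.erase k) / s * a² |y|²`, which is `a²/s² |y|²` times the
    -- contribution `s * D (T.erase k)` of `T` to `c₀`; so the ratio depends neither on `z` nor on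
    -- `c`.
    have h1 : ∀ T, c' T * (y ⬝ᵥ ((symForm (e T) (B T)).mulVec y)) ≤
        a ^ 2 / s ^ 2 * (∑ i, y i ^ 2) * (c T * (if k ∈ T then s * D (T.erase k) else D T)) := by
      intro T
      by_cases hk : k ∈ T
      · simp only [hc'def, if_pos hk]
        have h2 : y ⬝ᵥ ((symForm (e T) (B T)).mulVec y)
            ≤ D (T.erase k) / s * (a ^ 2 * ∑ i, y i ^ 2) := by
          rw [dotProduct_symForm_mulVec]
          refine (adjugate_form_le hs hd hsk _ (he0 T y)).trans ?_
          refine mul_le_mul_of_nonneg_left ?_ (div_pos (hDpos _) hs).le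
          rw [Finset.mul_sum]
          refine Finset.sum_le_sum fun j _ => ?_
          rw [Pi.mul_apply, mul_pow]
          exact mul_le_mul_of_nonneg_right (he1 T j) (sq_nonneg _)
        refine (mul_le_mul_of_nonneg_left h2 (hc T)).trans (le_of_eq ?_)
        field_simp
      · simp only [hc'def, if_neg hk, zero_mul]
        have := (hDpos T).le
        have := hc T
        positivity
    rw [hQform, hc₀]
    refine (Finset.sum_le_sum fun T _ => h1 T).trans (le_of_eq ?_)
    rw [← Finset.mul_sum]
    ring
  obtain ⟨m, w, hw, hwt⟩ := exists_sumSq_eq_of_posSemidef hQpsd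
  have key := gaussian_log_estimate w (c := c₀) (b := a ^ 2 / s ^ 2) hc₀pos (by positivity)
    fun y => by rw [hw]; exact hbound y
  have hu : u = fun y => Real.log ((c₀ + sumSq w y) / (c₀ + ∑ k, ∑ i, w k i ^ 2)) := by
    ext y
    simp only [u, hnum, hden, hw, hwt]
  rw [hu]
  exact key

/-! ### Averaging out all rows. -/

/-- The law of an `N × N` array of independent standard Gaussian variables. -/
noncomputable abbrev gaussianArray (N : ℕ) : Measure (Fin N → Fin N → ℝ) :=
  Measure.pi fun _ => stdGaussianPi (Fin N)

/-- Averaging the logarithm of `F` over one row, when the loss is controlled for each value of the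
other rows. -/
theorem integral_log_resample {N : ℕ} {k : Fin N} {F F' : (Fin N → Fin N → ℝ) → ℝ}
    (hF : Measurable F) (hF' : Measurable F') (hF0 : ∀ z, 0 < F z) (hF'0 : ∀ z, 0 < F' z) {δ C : ℝ}
    (h : ∀ z,
      Integrable (fun y => Real.log (F (Function.update z k y) / F' z)) (stdGaussianPi (Fin N)) ∧
      ∫ y, Real.log (F (Function.update z k y) / F' z) ∂(stdGaussianPi (Fin N)) ≤ 0 ∧
      -δ ≤ ∫ y, Real.log (F (Function.update z k y) / F' z) ∂(stdGaussianPi (Fin N)) ∧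
      ∫ y, ‖Real.log (F (Function.update z k y) / F' z)‖ ∂(stdGaussianPi (Fin N)) ≤ C)
    (hint : Integrable (fun z => Real.log (F' z)) (gaussianArray N)) :
    Integrable (fun z => Real.log (F z)) (gaussianArray N) ∧
    ∫ z, Real.log (F z) ∂(gaussianArray N) ≤ ∫ z, Real.log (F' z) ∂(gaussianArray N) ∧
    ∫ z, Real.log (F' z) ∂(gaussianArray N) - δ ≤ ∫ z, Real.log (F z) ∂(gaussianArray N) := by
  unfold gaussianArray at *
  have mp := measurePreserving_update (fun _ : Fin N => stdGaussianPi (Fin N)) k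
  have hFm : Measurable fun p : (Fin N → ℝ) × (Fin N → Fin N → ℝ) =>
      F (Function.update p.2 k p.1) := hF.comp mp.measurable
  set U : (Fin N → ℝ) × (Fin N → Fin N → ℝ) → ℝ :=
    fun p => Real.log (F (Function.update p.2 k p.1) / F' p.2) with hU
  have hUm : Measurable U :=
    Real.measurable_log.comp (hFm.div (hF'.comp measurable_snd))
  have hUi : Integrable U ((stdGaussianPi (Fin N)).prod (Measure.pi fun _ => stdGaussianPi (Fin N))) := by
    rw [integrable_prod_iff' hUm.aestronglyMeasurable]
    refine ⟨Filter.Eventually.of_forall fun z => (h z).1, ?_⟩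
    -- The bound `C` on the inner `L¹` norms is uniform in `z`, which gives joint integrability on
    -- the product.
    refine Integrable.of_bound (C := C)
      (hUm.norm.stronglyMeasurable.integral_prod_left').aestronglyMeasurable
      (Filter.Eventually.of_forall fun z => ?_)
    rw [Real.norm_of_nonneg (integral_nonneg fun _ => norm_nonneg _)]
    exact (h z).2.2.2
  have hVi : Integrable (fun p : (Fin N → ℝ) × (Fin N → Fin N → ℝ) => Real.log (F' p.2))
      ((stdGaussianPi (Fin N)).prod (Measure.pi fun _ => stdGaussianPi (Fin N))) :=
    hint.comp_snd _
  have hsum : (fun p : (Fin N → ℝ) × (Fin N → Fin N → ℝ) =>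
      Real.log (F (Function.update p.2 k p.1))) = fun p => U p + Real.log (F' p.2) := by
    ext p
    simp only [hU]
    rw [Real.log_div (hF0 _).ne' (hF'0 _).ne', sub_add_cancel]
  have hlm : Measurable fun z => Real.log (F z) := Real.measurable_log.comp hF
  have hi : Integrable (fun z => Real.log (F z)) (Measure.pi fun _ : Fin N => stdGaussianPi (Fin N)) := by
    rw [← mp.map_eq, integrable_map_measure hlm.aestronglyMeasurable mp.aemeasurable]
    change Integrable (fun p : (Fin N → ℝ) × (Fin N → Fin N → ℝ) =>
      Real.log (F (Function.update p.2 k p.1))) _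
    rw [hsum]
    exact hUi.add hVi
  have hval : ∫ z, Real.log (F z) ∂(Measure.pi fun _ : Fin N => stdGaussianPi (Fin N))
      = (∫ z, ∫ y, U (y, z) ∂(stdGaussianPi (Fin N))
          ∂(Measure.pi fun _ : Fin N => stdGaussianPi (Fin N)))
        + ∫ z, Real.log (F' z) ∂(Measure.pi fun _ : Fin N => stdGaussianPi (Fin N)) := by
    conv_lhs => rw [← mp.map_eq]
    rw [integral_map mp.aemeasurable hlm.aestronglyMeasurable, hsum, integral_add hUi hVi,
      integral_prod_symm _ hUi, integral_fun_snd fun z => Real.log (F' z)]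
    simp
  have hUz : Integrable (fun z => ∫ y, U (y, z) ∂(stdGaussianPi (Fin N)))
      (Measure.pi fun _ : Fin N => stdGaussianPi (Fin N)) := hUi.integral_prod_right
  have h1 : ∫ z, ∫ y, U (y, z) ∂(stdGaussianPi (Fin N))
      ∂(Measure.pi fun _ : Fin N => stdGaussianPi (Fin N)) ≤ 0 :=
    integral_nonpos fun z => (h z).2.1
  have h2 : -δ ≤ ∫ z, ∫ y, U (y, z) ∂(stdGaussianPi (Fin N))
      ∂(Measure.pi fun _ : Fin N => stdGaussianPi (Fin N)) := by
    have := integral_mono (integrable_const (-δ)) hUz fun z => (h z).2.2.1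
    simpa using this
  refine ⟨hi, ?_, ?_⟩ <;> rw [hval] <;> linarith

/-- The logarithm of a positive combination of principal minors, all rows averaged out. -/
theorem integral_log_sum_sampleMinor (hA : A.transpose = -A) (hs : 0 < s) {a : ℝ}
    (ha : ∀ i j, |A i j| ≤ a) (r : ℕ) (hr : r ≤ N) (c : Finset (Fin N) → ℝ) (hc : ∀ T, 0 ≤ c T)
    (hc' : ∃ T, 0 < c T) (hsupp : ∀ T, (∃ i : Fin N, i ∈ T ∧ (i : ℕ) + r < N) → c T = 0) :
    Integrable (fun z => Real.log (∑ T, c T * sampleMinor A s T z)) (gaussianArray N) ∧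
    ∫ z, Real.log (∑ T, c T * sampleMinor A s T z) ∂(gaussianArray N)
      ≤ Real.log (∑ T, c T * matchingSum (skewGraph A hA) (skewWeight A hA) s T) ∧
    Real.log (∑ T, c T * matchingSum (skewGraph A hA) (skewWeight A hA) s T)
        - r * min (a ^ 2 / s ^ 2 / 2) constC1
      ≤ ∫ z, Real.log (∑ T, c T * sampleMinor A s T z) ∂(gaussianArray N) := by
  induction r generalizing c with
  | zero =>
    have h0 : ∀ T, T ≠ ∅ → c T = 0 := by
      intro T hT
      obtain ⟨i, hi⟩ := Finset.nonempty_iff_ne_empty.2 hT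
      exact hsupp T ⟨i, hi, i.2⟩
    have hsum : ∀ g : Finset (Fin N) → ℝ, ∑ T, c T * g T = c ∅ * g ∅ := fun g =>
      Finset.sum_eq_single ∅ (fun T _ hT => by rw [h0 T hT, zero_mul]) (by simp)
    have hminor : ∀ z, sampleMinor A s ∅ z = 1 := fun z => by
      rw [sampleMinor, principalMask_empty, Matrix.det_one]
    simp [hsum, hminor, matchingSum_empty]
  | succ r ih =>
    -- The sets in the support have all their indices at least `N - (r + 1)`. Averaging out this
    -- smallest possible row leaves a combination supported on indices at least `N - r`.
    set k : Fin N := ⟨N - (r + 1), by omega⟩ with hk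
    have hsupp' : ∀ T, (∃ i ∈ T, i < k) → c T = 0 := by
      rintro T ⟨i, hi, hik⟩
      refine hsupp T ⟨i, hi, ?_⟩
      have : (i : ℕ) < N - (r + 1) := hik
      omega
    obtain ⟨i1, i2, i3⟩ := ih (by omega) (rowMeanCoeff A s k c) (rowMeanCoeff_nonneg hs k hc)
      (exists_rowMeanCoeff_pos hs k hc hc') (by
        rintro T ⟨i, hi, hir⟩
        refine rowMeanCoeff_eq_zero k hsupp' ⟨i, hi, ?_⟩
        change (i : ℕ) ≤ N - (r + 1)
        omega)
    -- `rowMean` of the matching sums is their recurrence at `k`.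
    have hmean : ∑ U, rowMeanCoeff A s k c U
          * matchingSum (skewGraph A hA) (skewWeight A hA) s U
        = ∑ T, c T * matchingSum (skewGraph A hA) (skewWeight A hA) s T := by
      rw [sum_rowMeanCoeff_mul]
      refine Finset.sum_congr rfl fun T _ => ?_
      congr 1
      unfold rowMean
      split_ifs with hkT
      · rw [matchingSum_eq_erase hs.ne' hkT]
        · congr 1
          refine Finset.sum_congr rfl fun j _ => ?_
          congr 1
          simp [skewWeight]
        · intro j hj
          have : A k j = 0 := not_not.1 hj
          simp [skewWeight, this]
      · rfl
    have hpos : ∀ (c : Finset (Fin N) → ℝ), (∀ T, 0 ≤ c T) → (∃ T, 0 < c T) → ∀ z,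
        0 < ∑ T, c T * sampleMinor A s T z := fun c hc hc' z =>
      sum_mul_pos hc hc' fun T => sampleMinor_pos hA hs T z
    have hmeas : ∀ c : Finset (Fin N) → ℝ, Measurable fun z => ∑ T, c T * sampleMinor A s T z :=
      fun c => Finset.measurable_sum _ fun T _ => (continuous_sampleMinor T).measurable.const_mul _
    obtain ⟨j1, j2, j3⟩ := integral_log_resample (hmeas c) (hmeas (rowMeanCoeff A s k c))
      (hpos c hc hc')
      (hpos _ (rowMeanCoeff_nonneg hs k hc) (exists_rowMeanCoeff_pos hs k hc hc'))
      (row_log_estimate hA hs ha hc hc' hsupp') i1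
    rw [hmean] at i2 i3
    refine ⟨j1, j2.trans i2, ?_⟩
    push_cast
    linarith

/-! ### Transfer to the given random variables. -/

/-- The entries on and above the diagonal of a Gaussian array are again independent standard
Gaussian variables. -/
theorem measurePreserving_upperPair (N : ℕ) :
    MeasurePreserving (fun (z : Fin N → Fin N → ℝ) (p : UpperPair N) => z p.1.1 p.1.2)
      (gaussianArray N) (stdGaussianPi (UpperPair N)) := by
  have hm : Measurable (fun (z : Fin N → Fin N → ℝ) (p : UpperPair N) => z p.1.1 p.1.2) := by
    fun_prop
  refine ⟨hm, ?_⟩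
  symm
  refine Measure.pi_eq fun S hS => ?_
  rw [Measure.map_apply hm (MeasurableSet.univ_pi hS)]
  -- Entries below the diagonal are unconstrained and contribute factors `1`.
  set R : Fin N → Fin N → Set ℝ := fun i j => if h : i ≤ j then S ⟨(i, j), h⟩ else Set.univ with hR
  have hpre : (fun (z : Fin N → Fin N → ℝ) (p : UpperPair N) => z p.1.1 p.1.2) ⁻¹' Set.univ.pi S
      = Set.univ.pi fun i => Set.univ.pi (R i) := by
    ext z
    simp only [Set.mem_preimage, Set.mem_pi, Set.mem_univ, forall_true_left]
    constructor
    · intro h i j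
      simp only [hR]
      split_ifs with hij
      · exact h ⟨(i, j), hij⟩
      · trivial
    · rintro h ⟨⟨i, j⟩, hij⟩
      have := h i j
      simp only [hR] at this
      rwa [dif_pos hij] at this
  rw [hpre, Measure.pi_pi]
  simp only [Measure.pi_pi]
  rw [← Finset.prod_product', Finset.univ_product_univ]
  have hone : ∀ p : Fin N × Fin N, ¬p.1 ≤ p.2 → gaussianReal 0 1 (R p.1 p.2) = 1 := by
    intro p hp
    simp only [hR]
    rw [dif_neg hp, measure_univ]
  rw [← Finset.prod_filter_of_ne (p := fun p : Fin N × Fin N => p.1 ≤ p.2)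
    fun p _ h => by by_contra h'; exact h (hone p h')]
  rw [Finset.prod_subtype (p := fun p : Fin N × Fin N => p.1 ≤ p.2) _ (by simp)]
  refine Finset.prod_congr rfl fun p _ => ?_
  simp only [hR]
  rw [dif_pos p.2]

end MatchingEstimate

open MatchingEstimate in
theorem theorem5p3 {N : ℕ} (A : Matrix (Fin N) (Fin N) ℝ) (hA : A.transpose = -A) (hA0 : A ≠ 0)
    (a : ℝ) (ha : IsGreatest (Set.range fun p : Fin N × Fin N => |A p.1 p.2|) a)
    (t : ℝ) (ht : 0 < t)
    {Ω : Type*} [MeasurableSpace Ω] (μ : MeasureTheory.Measure Ω)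
    [MeasureTheory.IsProbabilityMeasure μ]
    (x : MatchingEstimate.UpperPair N → Ω → ℝ)
    (hlaw : ∀ p, ProbabilityTheory.HasLaw (x p) (ProbabilityTheory.gaussianReal 0 1) μ)
    (hindep : ProbabilityTheory.iIndepFun x μ) :
    MeasureTheory.Integrable (fun ω => MatchingEstimate.logDet A t (fun p => x p ω)) μ ∧
    1 / (N : ℝ) * Real.log (MatchingEstimate.tildePhi μ x A t) ≤
      1 / (N : ℝ) * Real.log (MatchingEstimate.matchingPoly (MatchingEstimate.skewGraph A hA)
        (MatchingEstimate.skewWeight A hA) t) ∧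
    1 / (N : ℝ) * Real.log (MatchingEstimate.matchingPoly (MatchingEstimate.skewGraph A hA)
        (MatchingEstimate.skewWeight A hA) t) ≤
      1 / (N : ℝ) * Real.log (MatchingEstimate.tildePhi μ x A t) +
        min (a ^ 2 / (2 * t)) MatchingEstimate.constC1 := by
  have hN : 0 < N := by
    rcases Nat.eq_zero_or_pos N with rfl | h
    · exact absurd (Matrix.ext fun i => i.elim0) hA0
    · exact h
  have hs : 0 < √t := Real.sqrt_pos.2 ht
  -- All `N` rows are averaged, starting from the full determinant alone; the support condition is
  -- then vacuous.
  obtain ⟨k1, k2, k3⟩ := integral_log_sum_sampleMinor hA hs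
    (fun i j => ha.2 ⟨(i, j), rfl⟩) N le_rfl (Pi.single Finset.univ 1)
    (fun T => by rw [Pi.single_apply]; split_ifs <;> norm_num)
    ⟨Finset.univ, by simp⟩ (fun T ⟨i, _, h⟩ => by omega)
  have hsum : ∀ g : Finset (Fin N) → ℝ,
      ∑ T, (Pi.single Finset.univ 1 : Finset (Fin N) → ℝ) T * g T = g Finset.univ := fun g => by
    simp [Pi.single_apply]
  simp only [hsum, Real.sq_sqrt ht.le, div_div, mul_comm t 2] at k1 k2 k3
  have hlogm : Measurable fun ξ : UpperPair N → ℝ => logDet A t ξ := by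
    unfold logDet
    refine Real.measurable_log.comp (Continuous.measurable ?_)
    refine Continuous.matrix_det (continuous_matrix fun i j => ?_)
    simp only [Matrix.add_apply, sampleMatrix, Matrix.of_apply]
    fun_prop
  have hdiag : ∀ i, A i i = 0 := fun i => by
    have h1 : A i i = -A i i := congrFun (congrFun hA i) i
    linarith
  have hlog : ∀ z : Fin N → Fin N → ℝ, logDet A t (fun p => z p.1.1 p.1.2)
      = Real.log (sampleMinor A √t Finset.univ z) := by
    intro z
    rw [logDet, sampleMinor, principalMask_univ]
    congr 2
    ext i j
    by_cases hij : i = j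
    · subst hij
      simp [sampleMatrix, shiftedSample, hdiag]
    · simp [sampleMatrix, shiftedSample, hij]
  have hmap : μ.map (fun ω p => x p ω) = stdGaussianPi (UpperPair N) := by
    rw [(ProbabilityTheory.iIndepFun_iff_map_fun_eq_pi_map fun p => (hlaw p).aemeasurable).1 hindep]
    simp only [(hlaw _).map_eq]
  have hxm : AEMeasurable (fun ω p => x p ω) μ := aemeasurable_pi_lambda _ fun p => (hlaw p).aemeasurable
  have mp := measurePreserving_upperPair N
  have hint : MeasureTheory.Integrable (fun ω => logDet A t (fun p => x p ω)) μ := by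
    have h1 : MeasureTheory.Integrable (logDet A t) (stdGaussianPi (UpperPair N)) := by
      rw [← mp.integrable_comp hlogm.aestronglyMeasurable]
      exact k1.congr (Filter.Eventually.of_forall fun z => (hlog z).symm)
    rw [← hmap, MeasureTheory.integrable_map_measure hlogm.aestronglyMeasurable hxm] at h1
    exact h1
  have hval : ∫ ω, logDet A t (fun p => x p ω) ∂μ
      = ∫ z, Real.log (sampleMinor A √t Finset.univ z) ∂(gaussianArray N) := by
    rw [← MeasureTheory.integral_map hxm hlogm.aestronglyMeasurable, hmap, ← mp.map_eq,
      MeasureTheory.integral_map mp.aemeasurable hlogm.aestronglyMeasurable]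
    exact MeasureTheory.integral_congr_ae (Filter.Eventually.of_forall hlog)
  -- For odd `N` the `√t` in `matchingSum_univ` and the division by `√t` in `tildePhi` cancel, so
  -- both parities reduce to the same difference.
  have hpoly : Real.log (matchingPoly (skewGraph A hA) (skewWeight A hA) t)
      - Real.log (tildePhi μ x A t)
      = Real.log (matchingSum (skewGraph A hA) (skewWeight A hA) √t Finset.univ)
        - ∫ z, Real.log (sampleMinor A √t Finset.univ z) ∂(gaussianArray N) := by
    rw [tildePhi, hval, matchingSum_univ ht, Fintype.card_fin]
    split_ifs with h
    · rw [Nat.even_iff.1 h, pow_zero, one_mul, Real.log_exp]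
    · rw [Nat.not_even_iff.1 h, pow_one, Real.log_div (Real.exp_pos _).ne' hs.ne', Real.log_exp]
      have h1 := matchingSum_pos (G := skewGraph A hA) (w := skewWeight A hA) hs
        (fun e => e.ind fun i j => sq_nonneg |A i j|) Finset.univ
      rw [matchingSum_univ ht, Fintype.card_fin, Nat.not_even_iff.1 h, pow_one] at h1
      rw [Real.log_mul hs.ne' (pos_of_mul_pos_right h1 hs.le).ne']
      ring
  have hN' : (0 : ℝ) < 1 / N := by positivity
  refine ⟨hint, mul_le_mul_of_nonneg_left (by linarith) hN'.le, ?_⟩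
  rw [← sub_le_iff_le_add', ← mul_sub, hpoly, one_div_mul_eq_div, div_le_iff₀ (by positivity)]
  linarith
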